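/- All graphs are finite and simple. The distance between two edges of a graph $G$ is the minimum length of a path in $G$ joining an endpoint of one edge to an endpoint of the other. In particular, two edges are at distance exactly $1$ if and only if they share no vertex and some edge of $G$ joins an endpoint of one to an endpoint of the other. An edge coloring of $G$ (not necessarily proper) is called injective if any two distinct edges that are at distance exactly $1$ in $G$ or lie in a common triangle of $G$ receive distinct colors. The injective chromatic index $\chi'_{\mathrm{inj}}(G)$ is the minimum number of colors in an injective edge coloring of $G$. Theorem. Every subcubic graph $G$, that is, every graph with maximum degree at most $3$, satisfies $\chi'_{\mathrm{inj}}(G)\le 7$. -/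

import Mathlib

namespace SimpleGraph

variable {V : Type*}

/-- The distance between two edges of a graph: the length of a shortest path joining an
endpoint of one to an endpoint of the other (infinite if there is no such path).
Edges sharing a vertex are at distance `0`. -/
noncomputable def edgeEDist (G : SimpleGraph V) (e f : G.edgeSet) : ℕ∞ :=
  ⨅ u ∈ (e : Sym2 V), ⨅ v ∈ (f : Sym2 V), G.edist u v

/-- Two edges lie in a common triangle of the graph. -/
def InCommonTriangle (G : SimpleGraph V) (e f : G.edgeSet) : Prop :=
  ∃ t : Finset V, G.IsNClique 3 t ∧
    (∀ v ∈ (e : Sym2 V), v ∈ t) ∧ (∀ v ∈ (f : Sym2 V), v ∈ t)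

/-- An edge coloring is injective if any two distinct edges that are at distance exactly `1`
or in a common triangle get distinct colors. -/
def IsInjectiveEdgeColoring {G : SimpleGraph V} {K : Type*} (c : G.EdgeLabeling K) : Prop :=
  ∀ e f : G.edgeSet, e ≠ f → (G.edgeEDist e f = 1 ∨ G.InCommonTriangle e f) → c e ≠ c f

/-- The injective chromatic index: the least number of colors in an injective edge coloring
(infinite if no finite number of colors suffices). -/
noncomputable def injChromaticIndex (G : SimpleGraph V) : ℕ∞ :=
  ⨅ n ∈ {n : ℕ | ∃ c : G.EdgeLabeling (Fin n), IsInjectiveEdgeColoring c}, (n : ℕ∞)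

end SimpleGraph

/-!
The edge colouring problem is a vertex colouring problem for the conflict graph `conflictGraph G`:
two edges are in conflict when they are the end edges of a walk of three edges without
backtracking. If every degree in `G` is at most three, an edge is continued at each of its ends by
at most two edges, each of which is continued by at most two more, so every degree in the conflict
graph is at most eight (`degree_conflictGraph_le`).

A graph of maximum degree eight without four pairwise adjacent vertices is 7-colourable
(`colorable_seven_of_degree_le_eight`). Indeed, by Lovász's decomposition theorem
(`exists_lovasz_partition`) its vertices split into three classes inducing maximum degrees `0`, `3`
and `3`; the first class takes one colour, and each of the other two takes three colours by Brooks'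
theorem (`exists_properOn_three`). It remains to deal with the graphs `G` whose conflict graph
contains four pairwise adjacent vertices.

This is done by induction on `G`. Call a configuration reducible if its presence lets a colouring of
the edges avoiding some set of vertices (`DeletionColorable`, which follows from the induction
hypothesis) be extended to all edges. The following configurations are reducible.

* A vertex of degree one or two, two triangles with a common edge, and two vertices with three
  common neighbours: the deleted edges have at most six conflicts each.
* A triangle (`DeletionColorable.of_triangle`): the conflicts among the three edges of the triangle
  and the three edges leaving it form a triangular prism, all lists of available colours have three
  elements, and the prism is 3-choosable (`exists_coloring_prism`).
* A 4-cycle (`DeletionColorable.of_square`), by a similar statement on list colourings of the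
  conflict graph of the eight edges at the cycle (`exists_coloring_square`).
* A cycle of length eight with two crossing long chords (`DeletionColorable.of_octagon`): as any two
  sets of five of the seven colours have three common elements, the colours on the cycle can be
  chosen with so many coincidences that the edges leaving the cycle remain colourable.

If no vertex has degree one or two and there are no triangles and no 4-cycles, four pairwise
conflicting edges are pairwise disjoint, and the edges joining them are forced to form a cycle of
length eight with two crossing long chords (`exists_isChordedOctagon_of_clique`). So a graph
without reducible configurations has a conflict graph to which the colouring theorem applies.
-/

namespace SimpleGraph

/-! ### List colourings of three small graphs -/

section ListColoring

variable {α : Type*}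

theorem exists_mem_ne {L : Finset α} (h : 2 ≤ L.card) (a : α) : ∃ x ∈ L, x ≠ a := by
  obtain ⟨x, hx, hxa⟩ := Finset.exists_mem_notMem_of_card_lt_card
    (s := {a}) (t := L) (by rw [Finset.card_singleton]; omega)
  exact ⟨x, hx, by simpa using hxa⟩

/-- The 6-cycle is 2-choosable as soon as some list contains a colour missing from the
previous list: that colour is used first, and the cycle is closed at the previous vertex. -/
theorem exists_coloring_hexagon_of_notMem {L₁ L₂ L₃ L₄ L₅ L₆ : Finset α}
    (h₂ : 2 ≤ L₂.card) (h₃ : 2 ≤ L₃.card) (h₄ : 2 ≤ L₄.card) (h₅ : 2 ≤ L₅.card)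
    (h₆ : 2 ≤ L₆.card) (h : ¬ L₁ ⊆ L₆) :
    ∃ x₁ ∈ L₁, ∃ x₂ ∈ L₂, ∃ x₃ ∈ L₃, ∃ x₄ ∈ L₄, ∃ x₅ ∈ L₅, ∃ x₆ ∈ L₆,
      x₁ ≠ x₂ ∧ x₂ ≠ x₃ ∧ x₃ ≠ x₄ ∧ x₄ ≠ x₅ ∧ x₅ ≠ x₆ ∧ x₆ ≠ x₁ := by
  obtain ⟨x₁, m₁, n₁⟩ := Finset.not_subset.1 h
  obtain ⟨x₂, m₂, n₂⟩ := exists_mem_ne h₂ x₁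
  obtain ⟨x₃, m₃, n₃⟩ := exists_mem_ne h₃ x₂
  obtain ⟨x₄, m₄, n₄⟩ := exists_mem_ne h₄ x₃
  obtain ⟨x₅, m₅, n₅⟩ := exists_mem_ne h₅ x₄
  obtain ⟨x₆, m₆, n₆⟩ := exists_mem_ne h₆ x₅
  exact ⟨x₁, m₁, x₂, m₂, x₃, m₃, x₄, m₄, x₅, m₅, x₆, m₆, n₂.symm, n₃.symm, n₄.symm, n₅.symm,
    n₆.symm, fun e => n₁ (e ▸ m₆)⟩

variable [DecidableEq α]

theorem exists_mem_ne_ne {L : Finset α} (h : 3 ≤ L.card) (a b : α) :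
    ∃ x ∈ L, x ≠ a ∧ x ≠ b := by
  obtain ⟨x, hx, hxa⟩ := Finset.exists_mem_notMem_of_card_lt_card
    (s := {a, b}) (t := L) (by have := Finset.card_le_two (a := a) (b := b); omega)
  exact ⟨x, hx, by simpa using hxa⟩

theorem exists_mem_ne_ne_ne {L : Finset α} (h : 4 ≤ L.card) (a b c : α) :
    ∃ x ∈ L, x ≠ a ∧ x ≠ b ∧ x ≠ c := by
  obtain ⟨x, hx, hxa⟩ := Finset.exists_mem_notMem_of_card_lt_card
    (s := {a, b, c}) (t := L) (by have := Finset.card_le_three (a := a) (b := b) (c := c); omega)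
  exact ⟨x, hx, by simpa using hxa⟩

theorem le_card_erase {L : Finset α} {n : ℕ} (h : n + 1 ≤ L.card) (a : α) :
    n ≤ (L.erase a).card := by
  have := Finset.pred_card_le_card_erase (s := L) (a := a)
  omega

/-- The 6-cycle is 2-choosable. -/
theorem exists_coloring_hexagon {L₁ L₂ L₃ L₄ L₅ L₆ : Finset α}
    (h₁ : 2 ≤ L₁.card) (h₂ : 2 ≤ L₂.card) (h₃ : 2 ≤ L₃.card) (h₄ : 2 ≤ L₄.card)
    (h₅ : 2 ≤ L₅.card) (h₆ : 2 ≤ L₆.card) :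
    ∃ x₁ ∈ L₁, ∃ x₂ ∈ L₂, ∃ x₃ ∈ L₃, ∃ x₄ ∈ L₄, ∃ x₅ ∈ L₅, ∃ x₆ ∈ L₆,
      x₁ ≠ x₂ ∧ x₂ ≠ x₃ ∧ x₃ ≠ x₄ ∧ x₄ ≠ x₅ ∧ x₅ ≠ x₆ ∧ x₆ ≠ x₁ := by
  by_cases s₁ : L₁ ⊆ L₆
  swap
  · exact exists_coloring_hexagon_of_notMem h₂ h₃ h₄ h₅ h₆ s₁
  by_cases s₂ : L₂ ⊆ L₁
  swap
  · obtain ⟨x₂, m₂, x₃, m₃, x₄, m₄, x₅, m₅, x₆, m₆, x₁, m₁, a, b, c, d, e, f⟩ :=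
      exists_coloring_hexagon_of_notMem h₃ h₄ h₅ h₆ h₁ s₂
    exact ⟨x₁, m₁, x₂, m₂, x₃, m₃, x₄, m₄, x₅, m₅, x₆, m₆, f, a, b, c, d, e⟩
  by_cases s₃ : L₃ ⊆ L₂
  swap
  · obtain ⟨x₃, m₃, x₄, m₄, x₅, m₅, x₆, m₆, x₁, m₁, x₂, m₂, a, b, c, d, e, f⟩ :=
      exists_coloring_hexagon_of_notMem h₄ h₅ h₆ h₁ h₂ s₃
    exact ⟨x₁, m₁, x₂, m₂, x₃, m₃, x₄, m₄, x₅, m₅, x₆, m₆, e, f, a, b, c, d⟩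
  by_cases s₄ : L₄ ⊆ L₃
  swap
  · obtain ⟨x₄, m₄, x₅, m₅, x₆, m₆, x₁, m₁, x₂, m₂, x₃, m₃, a, b, c, d, e, f⟩ :=
      exists_coloring_hexagon_of_notMem h₅ h₆ h₁ h₂ h₃ s₄
    exact ⟨x₁, m₁, x₂, m₂, x₃, m₃, x₄, m₄, x₅, m₅, x₆, m₆, d, e, f, a, b, c⟩
  by_cases s₅ : L₅ ⊆ L₄
  swap
  · obtain ⟨x₅, m₅, x₆, m₆, x₁, m₁, x₂, m₂, x₃, m₃, x₄, m₄, a, b, c, d, e, f⟩ :=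
      exists_coloring_hexagon_of_notMem h₆ h₁ h₂ h₃ h₄ s₅
    exact ⟨x₁, m₁, x₂, m₂, x₃, m₃, x₄, m₄, x₅, m₅, x₆, m₆, c, d, e, f, a, b⟩
  by_cases s₆ : L₆ ⊆ L₅
  swap
  · obtain ⟨x₆, m₆, x₁, m₁, x₂, m₂, x₃, m₃, x₄, m₄, x₅, m₅, a, b, c, d, e, f⟩ :=
      exists_coloring_hexagon_of_notMem h₁ h₂ h₃ h₄ h₅ s₆
    exact ⟨x₁, m₁, x₂, m₂, x₃, m₃, x₄, m₄, x₅, m₅, x₆, m₆, b, c, d, e, f, a⟩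
  -- All lists are now equal, and two colours alternate around the cycle.
  obtain ⟨a, ha, b, hb, hab⟩ := Finset.one_lt_card.1 (show 1 < L₁.card by omega)
  have t₆ := s₁
  have t₅ := t₆.trans s₆
  have t₄ := t₅.trans s₅
  have t₃ := t₄.trans s₄
  have t₂ := t₃.trans s₃
  exact ⟨a, ha, b, t₂ hb, a, t₃ ha, b, t₄ hb, a, t₅ ha, b, t₆ hb, hab, hab.symm, hab, hab.symm,
    hab, hab.symm⟩

/-- The triangular prism is 3-choosable when two opposite vertices `x₁`, `y₂` can be given a
common colour: what remains is a path all of whose lists still have two colours. -/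
theorem exists_coloring_prism_of_not_disjoint {X₁ X₂ X₃ Y₁ Y₂ Y₃ : Finset α}
    (hX₂ : 3 ≤ X₂.card) (hX₃ : 3 ≤ X₃.card) (hY₁ : 3 ≤ Y₁.card) (hY₃ : 3 ≤ Y₃.card)
    (h : ¬ Disjoint X₁ Y₂) :
    ∃ x₁ ∈ X₁, ∃ x₂ ∈ X₂, ∃ x₃ ∈ X₃, ∃ y₁ ∈ Y₁, ∃ y₂ ∈ Y₂, ∃ y₃ ∈ Y₃,
      (x₁ ≠ x₂ ∧ x₂ ≠ x₃ ∧ x₁ ≠ x₃) ∧ (y₁ ≠ y₂ ∧ y₂ ≠ y₃ ∧ y₁ ≠ y₃) ∧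
      x₁ ≠ y₁ ∧ x₂ ≠ y₂ ∧ x₃ ≠ y₃ := by
  obtain ⟨t, tX, tY⟩ := Finset.not_disjoint_iff.1 h
  obtain ⟨x₂, m₂, n₂⟩ := exists_mem_ne (L := X₂) (by omega) t
  obtain ⟨x₃, m₃, n₃, n₃'⟩ := exists_mem_ne_ne hX₃ t x₂
  obtain ⟨y₃, l₃, k₃, k₃'⟩ := exists_mem_ne_ne hY₃ t x₃
  obtain ⟨y₁, l₁, k₁, k₁'⟩ := exists_mem_ne_ne hY₁ t y₃
  exact ⟨t, tX, x₂, m₂, x₃, m₃, y₁, l₁, t, tY, y₃, l₃, ⟨n₂.symm, n₃'.symm, n₃.symm⟩,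
    ⟨k₁, k₃.symm, k₁'⟩, k₁.symm, n₂, k₃'.symm⟩

/-- The triangular prism is 3-choosable. -/
theorem exists_coloring_prism {X₁ X₂ X₃ Y₁ Y₂ Y₃ : Finset α}
    (hX₁ : 3 ≤ X₁.card) (hX₂ : 3 ≤ X₂.card) (hX₃ : 3 ≤ X₃.card)
    (hY₁ : 3 ≤ Y₁.card) (hY₂ : 3 ≤ Y₂.card) (hY₃ : 3 ≤ Y₃.card) :
    ∃ x₁ ∈ X₁, ∃ x₂ ∈ X₂, ∃ x₃ ∈ X₃, ∃ y₁ ∈ Y₁, ∃ y₂ ∈ Y₂, ∃ y₃ ∈ Y₃,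
      (x₁ ≠ x₂ ∧ x₂ ≠ x₃ ∧ x₁ ≠ x₃) ∧ (y₁ ≠ y₂ ∧ y₂ ≠ y₃ ∧ y₁ ≠ y₃) ∧
      x₁ ≠ y₁ ∧ x₂ ≠ y₂ ∧ x₃ ≠ y₃ := by
  by_cases d₁₂ : Disjoint X₁ Y₂
  swap
  · exact exists_coloring_prism_of_not_disjoint hX₂ hX₃ hY₁ hY₃ d₁₂
  by_cases d₁₃ : Disjoint X₁ Y₃
  swap
  · obtain ⟨x₁, a₁, x₃, a₃, x₂, a₂, y₁, b₁, y₃, b₃, y₂, b₂, h⟩ :=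
      exists_coloring_prism_of_not_disjoint hX₃ hX₂ hY₁ hY₂ d₁₃
    exact ⟨x₁, a₁, x₂, a₂, x₃, a₃, y₁, b₁, y₂, b₂, y₃, b₃, by grind⟩
  by_cases d₂₁ : Disjoint X₂ Y₁
  swap
  · obtain ⟨x₂, a₂, x₁, a₁, x₃, a₃, y₂, b₂, y₁, b₁, y₃, b₃, h⟩ :=
      exists_coloring_prism_of_not_disjoint hX₁ hX₃ hY₂ hY₃ d₂₁
    exact ⟨x₁, a₁, x₂, a₂, x₃, a₃, y₁, b₁, y₂, b₂, y₃, b₃, by grind⟩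
  by_cases d₂₃ : Disjoint X₂ Y₃
  swap
  · obtain ⟨x₂, a₂, x₃, a₃, x₁, a₁, y₂, b₂, y₃, b₃, y₁, b₁, h⟩ :=
      exists_coloring_prism_of_not_disjoint hX₃ hX₁ hY₂ hY₁ d₂₃
    exact ⟨x₁, a₁, x₂, a₂, x₃, a₃, y₁, b₁, y₂, b₂, y₃, b₃, by grind⟩
  by_cases d₃₁ : Disjoint X₃ Y₁
  swap
  · obtain ⟨x₃, a₃, x₁, a₁, x₂, a₂, y₃, b₃, y₁, b₁, y₂, b₂, h⟩ :=
      exists_coloring_prism_of_not_disjoint hX₁ hX₂ hY₃ hY₂ d₃₁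
    exact ⟨x₁, a₁, x₂, a₂, x₃, a₃, y₁, b₁, y₂, b₂, y₃, b₃, by grind⟩
  have ne_of_disjoint {A B : Finset α} (h : Disjoint A B) {a b : α} (ha : a ∈ A) (hb : b ∈ B) :
      a ≠ b := fun e => Finset.disjoint_left.1 h ha (e ▸ hb)
  -- If one of the three edges joining the triangles has disjoint lists, it is harmless, and the
  -- greedy colouring of both triangles ends at that edge.
  by_cases d₁₁ : Disjoint X₁ Y₁
  · obtain ⟨x₂, a₂⟩ := Finset.card_pos.1 (show 0 < X₂.card by omega)
    obtain ⟨x₃, a₃, m₃⟩ := exists_mem_ne (show 2 ≤ X₃.card by omega) x₂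
    obtain ⟨x₁, a₁, m₁, m₁'⟩ := exists_mem_ne_ne hX₁ x₂ x₃
    obtain ⟨y₂, b₂, n₂⟩ := exists_mem_ne (show 2 ≤ Y₂.card by omega) x₂
    obtain ⟨y₃, b₃, n₃, n₃'⟩ := exists_mem_ne_ne hY₃ y₂ x₃
    obtain ⟨y₁, b₁, n₁, n₁'⟩ := exists_mem_ne_ne hY₁ y₂ y₃
    have := ne_of_disjoint d₁₁ a₁ b₁
    exact ⟨x₁, a₁, x₂, a₂, x₃, a₃, y₁, b₁, y₂, b₂, y₃, b₃, by grind⟩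
  by_cases d₂₂ : Disjoint X₂ Y₂
  · obtain ⟨x₁, a₁⟩ := Finset.card_pos.1 (show 0 < X₁.card by omega)
    obtain ⟨x₃, a₃, m₃⟩ := exists_mem_ne (show 2 ≤ X₃.card by omega) x₁
    obtain ⟨x₂, a₂, m₂, m₂'⟩ := exists_mem_ne_ne hX₂ x₁ x₃
    obtain ⟨y₁, b₁, n₁⟩ := exists_mem_ne (show 2 ≤ Y₁.card by omega) x₁
    obtain ⟨y₃, b₃, n₃, n₃'⟩ := exists_mem_ne_ne hY₃ y₁ x₃
    obtain ⟨y₂, b₂, n₂, n₂'⟩ := exists_mem_ne_ne hY₂ y₁ y₃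
    have := ne_of_disjoint d₂₂ a₂ b₂
    exact ⟨x₁, a₁, x₂, a₂, x₃, a₃, y₁, b₁, y₂, b₂, y₃, b₃, by grind⟩
  -- Otherwise a common colour of `X₁` and `Y₁` goes to `x₁`, and one of `X₂` and `Y₂` to `y₂`:
  -- by disjointness these exclude nothing except at `y₁` and at `x₂`.
  obtain ⟨x₁, a₁, a₁'⟩ := Finset.not_disjoint_iff.1 d₁₁
  obtain ⟨y₂, b₂', b₂⟩ := Finset.not_disjoint_iff.1 d₂₂
  obtain ⟨y₁, b₁, n₁⟩ := exists_mem_ne (show 2 ≤ Y₁.card by omega) x₁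
  obtain ⟨x₂, a₂, n₂⟩ := exists_mem_ne (show 2 ≤ X₂.card by omega) y₂
  obtain ⟨x₃, a₃, n₃⟩ := exists_mem_ne (show 2 ≤ X₃.card by omega) x₂
  obtain ⟨y₃, b₃, m₃, m₃'⟩ := exists_mem_ne_ne hY₃ y₁ x₃
  have e₁ := ne_of_disjoint d₂₁ a₂ a₁'
  have e₂ := ne_of_disjoint d₃₁ a₃ a₁'
  have e₃ := ne_of_disjoint d₂₁ b₂' b₁
  have e₄ := ne_of_disjoint d₂₃ b₂' b₃
  exact ⟨x₁, a₁, x₂, a₂, x₃, a₃, y₁, b₁, y₂, b₂, y₃, b₃, by grind⟩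

/-- The conflict graph of the edges `cᵢ` of a 4-cycle and of the edges `pᵢ` leaving it, in the
case that colours of `p₀` and `p₂` are at hand that leave two colours for `p₁` and for `p₃`:
what remains is a 6-cycle. -/
theorem exists_coloring_square_of_pair {L₁ L₃ M₀ M₁ M₂ M₃ : Finset α} (p₀ p₂ : α)
    (h₁ : 2 ≤ (L₁ \ {p₀, p₂}).card) (h₃ : 2 ≤ (L₃ \ {p₀, p₂}).card)
    (k₀ : 3 ≤ M₀.card) (k₁ : 3 ≤ M₁.card) (k₂ : 3 ≤ M₂.card) (k₃ : 3 ≤ M₃.card) :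
    ∃ p₁ ∈ L₁, ∃ p₃ ∈ L₃, ∃ c₀ ∈ M₀, ∃ c₁ ∈ M₁, ∃ c₂ ∈ M₂, ∃ c₃ ∈ M₃,
      (p₀ ≠ p₁ ∧ p₁ ≠ p₂ ∧ p₂ ≠ p₃ ∧ p₃ ≠ p₀) ∧ (c₀ ≠ c₂ ∧ c₁ ≠ c₃) ∧
      (p₀ ≠ c₁ ∧ p₀ ≠ c₂) ∧ (p₁ ≠ c₂ ∧ p₁ ≠ c₃) ∧ (p₂ ≠ c₃ ∧ p₂ ≠ c₀) ∧ p₃ ≠ c₀ ∧ p₃ ≠ c₁ := by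
  obtain ⟨p₁, m₁, c₂, m₂, c₀, m₀, p₃, m₃, c₁, n₁, c₃, n₃, h⟩ :=
    exists_coloring_hexagon h₁ (le_card_erase k₂ p₀) (le_card_erase k₀ p₂) h₃
      (le_card_erase k₁ p₀) (le_card_erase k₃ p₂)
  simp only [Finset.mem_sdiff, Finset.mem_insert, Finset.mem_singleton, Finset.mem_erase,
    not_or] at m₁ m₂ m₀ m₃ n₁ n₃
  exact ⟨p₁, m₁.1, p₃, m₃.1, c₀, m₀.2, c₁, n₁.2, c₂, m₂.2, c₃, n₃.2, by grind⟩

theorem two_le_card_sdiff_pair {L : Finset α} {a b : α} (h : 3 ≤ L.card)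
    (hab : a ∉ L ∨ b ∉ L ∨ a = b) : 2 ≤ (L \ {a, b}).card := by
  have key : ∃ c, L.erase c ⊆ L \ {a, b} := by
    rcases hab with h | h | h
    · exact ⟨b, fun x hx => by grind⟩
    · exact ⟨a, fun x hx => by grind⟩
    · exact ⟨a, fun x hx => by grind⟩
  obtain ⟨c, hc⟩ := key
  exact (le_card_erase h c).trans (Finset.card_le_card hc)

/-- Two disjoint lists of three colours contain a pair of colours that costs each of two given
lists of size three at most one colour. -/
theorem exists_pair_of_disjoint {A B L L' : Finset α} (hA : A.card = 3) (hB : B.card = 3)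
    (hL : L.card = 3) (hL' : L'.card = 3) (hd : Disjoint A B) :
    ∃ a ∈ A, ∃ b ∈ B, (a ∉ L ∨ b ∉ L) ∧ (a ∉ L' ∨ b ∉ L') := by
  by_cases h : A ⊆ L
  · have e : A = L := Finset.eq_of_subset_of_card_le h (by omega)
    subst e
    by_cases h' : A ⊆ L'
    · have e : A = L' := Finset.eq_of_subset_of_card_le h' (by omega)
      subst e
      obtain ⟨a, ha⟩ := Finset.card_pos.1 (show 0 < A.card by omega)
      obtain ⟨b, hb⟩ := Finset.card_pos.1 (show 0 < B.card by omega)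
      have := Finset.disjoint_right.1 hd hb
      exact ⟨a, ha, b, hb, .inr this, .inr this⟩
    · obtain ⟨a, ha, ha'⟩ := Finset.not_subset.1 h'
      obtain ⟨b, hb⟩ := Finset.card_pos.1 (show 0 < B.card by omega)
      exact ⟨a, ha, b, hb, .inr (Finset.disjoint_right.1 hd hb), .inl ha'⟩
  · obtain ⟨a, ha, ha'⟩ := Finset.not_subset.1 h
    by_cases h' : B ⊆ L'
    · have e : B = L' := Finset.eq_of_subset_of_card_le h' (by omega)
      subst e
      obtain ⟨b, hb⟩ := Finset.card_pos.1 (show 0 < B.card by omega)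
      exact ⟨a, ha, b, hb, .inl ha', .inl (Finset.disjoint_left.1 hd ha)⟩
    · obtain ⟨b, hb, hb'⟩ := Finset.not_subset.1 h'
      exact ⟨a, ha, b, hb, .inl ha', .inr hb'⟩

/-- The case of `exists_coloring_square` in which only `p₀` and `p₂` can be in conflict. -/
theorem exists_coloring_square_of_imp {L₀ L₁ L₂ L₃ M₀ M₁ M₂ M₃ : Finset α} {P : Prop}
    (h₀ : 3 ≤ L₀.card) (h₁ : 3 ≤ L₁.card) (h₂ : 3 ≤ L₂.card) (h₃ : 3 ≤ L₃.card)
    (k₀ : 3 ≤ M₀.card) (k₁ : 3 ≤ M₁.card) (k₂ : 3 ≤ M₂.card) (k₃ : 3 ≤ M₃.card)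
    (hP : P → 4 ≤ L₀.card ∧ 4 ≤ L₂.card) :
    ∃ p₀ ∈ L₀, ∃ p₁ ∈ L₁, ∃ p₂ ∈ L₂, ∃ p₃ ∈ L₃, ∃ c₀ ∈ M₀, ∃ c₁ ∈ M₁, ∃ c₂ ∈ M₂, ∃ c₃ ∈ M₃,
      (P → p₀ ≠ p₂) ∧ (p₀ ≠ p₁ ∧ p₁ ≠ p₂ ∧ p₂ ≠ p₃ ∧ p₃ ≠ p₀) ∧ (c₀ ≠ c₂ ∧ c₁ ≠ c₃) ∧
      (p₀ ≠ c₁ ∧ p₀ ≠ c₂) ∧ (p₁ ≠ c₂ ∧ p₁ ≠ c₃) ∧ (p₂ ≠ c₃ ∧ p₂ ≠ c₀) ∧ p₃ ≠ c₀ ∧ p₃ ≠ c₁ := by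
  obtain ⟨K₁, s₁, h₁⟩ := Finset.exists_subset_card_eq h₁
  obtain ⟨K₃, s₃, h₃⟩ := Finset.exists_subset_card_eq h₃
  suffices key : ∃ p₀ ∈ L₀, ∃ p₂ ∈ L₂, (P → p₀ ≠ p₂) ∧ (p₀ ∉ K₁ ∨ p₂ ∉ K₁ ∨ p₀ = p₂) ∧
      (p₀ ∉ K₃ ∨ p₂ ∉ K₃ ∨ p₀ = p₂) by
    obtain ⟨p₀, m₀, p₂, m₂, hne, e₁, e₃⟩ := key
    obtain ⟨p₁, m₁, p₃, m₃, c₀, n₀, c₁, n₁, c₂, n₂, c₃, n₃, h⟩ :=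
      exists_coloring_square_of_pair p₀ p₂ (two_le_card_sdiff_pair h₁.ge e₁)
        (two_le_card_sdiff_pair h₃.ge e₃) k₀ k₁ k₂ k₃
    exact ⟨p₀, m₀, p₁, s₁ m₁, p₂, m₂, p₃, s₃ m₃, c₀, n₀, c₁, n₁, c₂, n₂, c₃, n₃, hne, h⟩
  by_cases hp : P
  · obtain ⟨a, ha, ha'⟩ := Finset.exists_mem_notMem_of_card_lt_card
      (s := K₁) (t := L₀) (by have := hP hp; omega)
    obtain ⟨b, hb, hb'⟩ := Finset.exists_mem_notMem_of_card_lt_card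
      (s := K₃) (t := L₂) (by have := hP hp; omega)
    by_cases hab : a = b
    · subst hab
      obtain ⟨b, hb, hba⟩ := exists_mem_ne (L := L₂) (by omega) a
      exact ⟨a, ha, b, hb, fun _ => hba.symm, .inl ha', .inl hb'⟩
    · exact ⟨a, ha, b, hb, fun _ => hab, .inl ha', .inr (.inl hb')⟩
  · by_cases hd : Disjoint L₀ L₂
    · obtain ⟨K₀, s₀, h₀⟩ := Finset.exists_subset_card_eq h₀
      obtain ⟨K₂, s₂, h₂⟩ := Finset.exists_subset_card_eq h₂
      obtain ⟨a, ha, b, hb, e₁, e₃⟩ := exists_pair_of_disjoint h₀ h₂ h₁ h₃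
        (hd.mono s₀ s₂)
      exact ⟨a, s₀ ha, b, s₂ hb, fun h => absurd h hp, by tauto, by tauto⟩
    · obtain ⟨t, t₀, t₂⟩ := Finset.not_disjoint_iff.1 hd
      exact ⟨t, t₀, t, t₂, fun h => absurd h hp, .inr (.inr rfl), .inr (.inr rfl)⟩

/-- The case of `exists_coloring_square` in which `p₀, p₁, p₂, p₃` are pairwise in conflict. -/
theorem exists_coloring_square_of_four_le {L₀ L₁ L₂ L₃ M₀ M₁ M₂ M₃ : Finset α}
    (h₀ : 4 ≤ L₀.card) (h₁ : 4 ≤ L₁.card) (h₂ : 4 ≤ L₂.card) (h₃ : 4 ≤ L₃.card)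
    (k₀ : 3 ≤ M₀.card) (k₁ : 3 ≤ M₁.card) (k₂ : M₂.card = 3) (k₃ : M₃.card = 3) :
    ∃ p₀ ∈ L₀, ∃ p₁ ∈ L₁, ∃ p₂ ∈ L₂, ∃ p₃ ∈ L₃, ∃ c₀ ∈ M₀, ∃ c₁ ∈ M₁, ∃ c₂ ∈ M₂, ∃ c₃ ∈ M₃,
      p₀ ≠ p₂ ∧ p₁ ≠ p₃ ∧ (p₀ ≠ p₁ ∧ p₁ ≠ p₂ ∧ p₂ ≠ p₃ ∧ p₃ ≠ p₀) ∧ (c₀ ≠ c₂ ∧ c₁ ≠ c₃) ∧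
      (p₀ ≠ c₁ ∧ p₀ ≠ c₂) ∧ (p₁ ≠ c₂ ∧ p₁ ≠ c₃) ∧ (p₂ ≠ c₃ ∧ p₂ ≠ c₀) ∧ p₃ ≠ c₀ ∧ p₃ ≠ c₁ := by
  -- It suffices that one of `p₀`, `p₁` has a colour outside `M₂` and one of `p₁`, `p₂` has a
  -- colour outside `M₃`: then `c₂` and `c₃` keep two colours and can be chosen last.
  suffices key : ∃ p₀ ∈ L₀, ∃ p₁ ∈ L₁, ∃ p₂ ∈ L₂, ∃ p₃ ∈ L₃, p₀ ≠ p₂ ∧ p₁ ≠ p₃ ∧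
      (p₀ ≠ p₁ ∧ p₁ ≠ p₂ ∧ p₂ ≠ p₃ ∧ p₃ ≠ p₀) ∧ (p₀ ∉ M₂ ∨ p₁ ∉ M₂) ∧ (p₁ ∉ M₃ ∨ p₂ ∉ M₃) by
    obtain ⟨p₀, m₀, p₁, m₁, p₂, m₂, p₃, m₃, e₁, e₂, e₃, e₄, e₅⟩ := key
    obtain ⟨c₀, n₀, f₀, f₀'⟩ := exists_mem_ne_ne k₀ p₂ p₃
    obtain ⟨c₁, n₁, f₁, f₁'⟩ := exists_mem_ne_ne k₁ p₀ p₃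
    obtain ⟨c₂, n₂, f₂⟩ := exists_mem_ne
      (two_le_card_sdiff_pair k₂.ge (e₄.imp_right Or.inl)) c₀
    obtain ⟨c₃, n₃, f₃⟩ := exists_mem_ne
      (two_le_card_sdiff_pair k₃.ge (e₅.imp_right Or.inl)) c₁
    simp only [Finset.mem_sdiff, Finset.mem_insert, Finset.mem_singleton, not_or] at n₂ n₃
    exact ⟨p₀, m₀, p₁, m₁, p₂, m₂, p₃, m₃, c₀, n₀, c₁, n₁, c₂, n₂.1, c₃, n₃.1, by grind⟩
  obtain ⟨a, ha, ha'⟩ := Finset.exists_mem_notMem_of_card_lt_card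
    (s := M₂) (t := L₀) (by omega)
  obtain ⟨b, hb, hb'⟩ := Finset.exists_mem_notMem_of_card_lt_card
    (s := M₃) (t := L₁) (by omega)
  by_cases hab : a = b
  · subst hab
    obtain ⟨p₀, m₀, n₀⟩ := exists_mem_ne (L := L₀) (by omega) a
    obtain ⟨p₂, m₂, n₂, n₂'⟩ := exists_mem_ne_ne (L := L₂) (by omega) a p₀
    obtain ⟨p₃, m₃, n₃, n₃', n₃''⟩ := exists_mem_ne_ne_ne h₃ a p₀ p₂
    exact ⟨p₀, m₀, a, hb, p₂, m₂, p₃, m₃, by grind⟩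
  · obtain ⟨p₂, m₂, n₂, n₂'⟩ := exists_mem_ne_ne (L := L₂) (by omega) a b
    obtain ⟨p₃, m₃, n₃, n₃', n₃''⟩ := exists_mem_ne_ne_ne h₃ a b p₂
    exact ⟨a, ha, b, hb, p₂, m₂, p₃, m₃, by grind⟩

/-- List colouring of the conflict graph formed by the edges `cᵢ` of a 4-cycle and the edges
`pᵢ` leaving it at its vertices: `cᵢ` is the edge from the vertex of `pᵢ` to that of `pᵢ₊₁`.
The conditions `P` and `Q` say that `p₀`, `p₂`, respectively `p₁`, `p₃`, are in conflict. -/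
theorem exists_coloring_square {L₀ L₁ L₂ L₃ M₀ M₁ M₂ M₃ : Finset α} {P Q : Prop}
    (h₀ : 3 ≤ L₀.card) (h₁ : 3 ≤ L₁.card) (h₂ : 3 ≤ L₂.card) (h₃ : 3 ≤ L₃.card)
    (k₀ : 3 ≤ M₀.card) (k₁ : 3 ≤ M₁.card) (k₂ : 3 ≤ M₂.card) (k₃ : 3 ≤ M₃.card)
    (hP : P → 4 ≤ L₀.card ∧ 4 ≤ L₂.card) (hQ : Q → 4 ≤ L₁.card ∧ 4 ≤ L₃.card) :
    ∃ p₀ ∈ L₀, ∃ p₁ ∈ L₁, ∃ p₂ ∈ L₂, ∃ p₃ ∈ L₃, ∃ c₀ ∈ M₀, ∃ c₁ ∈ M₁, ∃ c₂ ∈ M₂, ∃ c₃ ∈ M₃,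
      (P → p₀ ≠ p₂) ∧ (Q → p₁ ≠ p₃) ∧ (p₀ ≠ p₁ ∧ p₁ ≠ p₂ ∧ p₂ ≠ p₃ ∧ p₃ ≠ p₀) ∧
      (c₀ ≠ c₂ ∧ c₁ ≠ c₃) ∧
      (p₀ ≠ c₁ ∧ p₀ ≠ c₂) ∧ (p₁ ≠ c₂ ∧ p₁ ≠ c₃) ∧ (p₂ ≠ c₃ ∧ p₂ ≠ c₀) ∧ p₃ ≠ c₀ ∧ p₃ ≠ c₁ := by
  by_cases hq : Q
  · by_cases hp : P
    · obtain ⟨K₂, s₂, k₂⟩ := Finset.exists_subset_card_eq k₂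
      obtain ⟨K₃, s₃, k₃⟩ := Finset.exists_subset_card_eq k₃
      obtain ⟨p₀, m₀, p₁, m₁, p₂, m₂, p₃, m₃, c₀, n₀, c₁, n₁, c₂, n₂, c₃, n₃, h⟩ :=
        exists_coloring_square_of_four_le (hP hp).1 (hQ hq).1 (hP hp).2 (hQ hq).2 k₀ k₁ k₂ k₃
      exact ⟨p₀, m₀, p₁, m₁, p₂, m₂, p₃, m₃, c₀, n₀, c₁, n₁, c₂, s₂ n₂, c₃, s₃ n₃, by tauto⟩
    · obtain ⟨p₁, m₁, p₂, m₂, p₃, m₃, p₀, m₀, c₁, n₁, c₂, n₂, c₃, n₃, c₀, n₀, h⟩ :=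
        exists_coloring_square_of_imp h₁ h₂ h₃ h₀ k₁ k₂ k₃ k₀ hQ
      refine ⟨p₀, m₀, p₁, m₁, p₂, m₂, p₃, m₃, c₀, n₀, c₁, n₁, c₂, n₂, c₃, n₃, ?_⟩
      have := h.1 hq
      have := h.2.2.1.2.symm
      tauto
  · obtain ⟨p₀, m₀, p₁, m₁, p₂, m₂, p₃, m₃, c₀, n₀, c₁, n₁, c₂, n₂, c₃, n₃, h⟩ :=
      exists_coloring_square_of_imp h₀ h₁ h₂ h₃ k₀ k₁ k₂ k₃ hP
    exact ⟨p₀, m₀, p₁, m₁, p₂, m₂, p₃, m₃, c₀, n₀, c₁, n₁, c₂, n₂, c₃, n₃, by tauto⟩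

end ListColoring

/-! ### Partial proper colourings and Brooks' theorem for maximum degree three -/

section Brooks

variable {W : Type*} {K : Type*}

/-- The map `c` is a proper colouring of `H` on the set `Y`: adjacent vertices of `Y` get
distinct colours. Outside `Y` its values are irrelevant. -/
def ProperOn (H : SimpleGraph W) (c : W → K) (Y : Set W) : Prop :=
  ∀ x ∈ Y, ∀ y ∈ Y, H.Adj x y → c x ≠ c y

theorem ProperOn.mono {H : SimpleGraph W} {c : W → K} {Y Z : Set W} (h : ProperOn H c Y)
    (hZ : Z ⊆ Y) : ProperOn H c Z :=
  fun x hx y hy => h x (hZ hx) y (hZ hy)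

theorem ProperOn.colorable {H : SimpleGraph W} {n : ℕ} {c : W → Fin n} {Y : Set W}
    (h : ProperOn H c Y) (hY : ∀ x y, H.Adj x y → x ∈ Y) : H.Colorable n :=
  ⟨Coloring.mk c fun {x y} hxy => h x (hY x y hxy) y (hY y x hxy.symm) hxy⟩

/-- A colouring on `Y` and a colouring `d` on `F` combine when `d` respects the colours seen
outside `F`. -/
theorem ProperOn.exists_union {H : SimpleGraph W} {c : W → K} {Y F : Set W} (hc : ProperOn H c Y)
    (d : W → K) (hd : ProperOn H d F)
    (hcd : ∀ e ∈ F, ∀ f ∈ Y, f ∉ F → H.Adj e f → d e ≠ c f) :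
    ∃ c' : W → K, ProperOn H c' (Y ∪ F) ∧ (∀ e ∈ F, c' e = d e) ∧ ∀ e ∉ F, c' e = c e := by
  classical
  refine ⟨fun e => if e ∈ F then d e else c e, ?_, fun e he => if_pos he, fun e he => if_neg he⟩
  intro x hx y hy hxy
  by_cases hxF : x ∈ F <;> by_cases hyF : y ∈ F <;> simp only [hxF, hyF, if_true, if_false]
  · exact hd x hxF y hyF hxy
  · exact hcd x hxF y (hy.resolve_right hyF) hyF hxy
  · exact (hcd y hyF x (hx.resolve_right hxF) hxF hxy.symm).symm
  · exact hc x (hx.resolve_right hxF) y (hy.resolve_right hyF) hxy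

/-- One more vertex can be coloured if its coloured neighbours show fewer colours than there
are. -/
theorem ProperOn.exists_insert {H : SimpleGraph W} {n : ℕ} {c : W → Fin n} {Y : Set W}
    (hc : ProperOn H c Y) {v : W} (B : Finset (Fin n)) (hB : B.card < n)
    (hv : ∀ y ∈ Y, y ≠ v → H.Adj v y → c y ∈ B) :
    ∃ c' : W → Fin n, ProperOn H c' (insert v Y) ∧ ∀ e, e ≠ v → c' e = c e := by
  obtain ⟨k, -, hk⟩ := Finset.exists_mem_notMem_of_card_lt_card
    (s := B) (t := Finset.univ) (by simpa using hB)
  obtain ⟨c', h₁, -, h₃⟩ := hc.exists_union (F := {v}) (fun _ => k)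
    (by rintro x rfl y rfl h; exact absurd h (H.loopless.irrefl _))
    (by
      rintro x rfl y hy hyx hxy rfl
      exact hk (hv y hy hyx hxy))
  refine ⟨c', ?_, fun e he => h₃ e he⟩
  rwa [Set.union_singleton] at h₁

theorem exists_adj_of_isChain {H : SimpleGraph W} {l : List W} {z : W}
    (h : (l ++ [z]).IsChain H.Adj) (l₁ : List W) (x : W) (l₂ : List W) (e : l = l₁ ++ x :: l₂) :
    ∃ y ∈ l₂ ++ [z], H.Adj x y := by
  subst e
  rw [List.append_assoc, List.cons_append] at h
  have h := (List.isChain_append.1 h).2.1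
  cases l₂ with
  | nil => exact ⟨z, by simp, (List.isChain_cons_cons.1 h).1⟩
  | cons y l₂ => exact ⟨y, by simp, (List.isChain_cons_cons.1 h).1⟩

theorem exists_split_last {l : List W} {p : W → Prop} (h : ∃ x ∈ l, p x) :
    ∃ l₁ x l₂, l = l₁ ++ x :: l₂ ∧ p x ∧ ∀ y ∈ l₂, ¬ p y := by
  induction l with
  | nil => simp at h
  | cons a l ih =>
    by_cases h' : ∃ x ∈ l, p x
    · obtain ⟨l₁, x, l₂, rfl, h₁, h₂⟩ := ih h'
      exact ⟨a :: l₁, x, l₂, rfl, h₁, h₂⟩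
    · refine ⟨[], a, l, rfl, ?_, fun y hy hp => h' ⟨y, hy, hp⟩⟩
      obtain ⟨x, hx, hp⟩ := h
      rcases List.mem_cons.1 hx with rfl | hx
      · exact hp
      · exact absurd ⟨x, hx, hp⟩ h'

theorem exists_split_step {l : List W} {p : W → Prop} {a : W} (ha : ¬ p a)
    (h : ∃ x ∈ l, p x) : ∃ l₁ x y l₂, a :: l = l₁ ++ x :: y :: l₂ ∧ ¬ p x ∧ p y := by
  induction l generalizing a with
  | nil => simp at h
  | cons b l ih =>
    by_cases hb : p b
    · exact ⟨[], a, b, l, rfl, ha, hb⟩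
    · obtain ⟨l₁, x, y, l₂, e, h₁, h₂⟩ := ih hb (by
        obtain ⟨x, hx, hp⟩ := h
        rcases List.mem_cons.1 hx with rfl | hx
        · exact absurd hp hb
        · exact ⟨x, hx, hp⟩)
      exact ⟨a :: l₁, x, y, l₂, by rw [e]; rfl, h₁, h₂⟩

/-- A finite nonempty set `X` closed under taking neighbours contains a cycle through a vertex
all of whose neighbours lie on the cycle. The cycle is cut off a path that cannot be prolonged at
its first vertex; the concatenation of the list with itself being a path of the graph expresses
that the list closes up. -/
theorem exists_cycle_list {H : SimpleGraph W} {X : Finset W} (hX : X.Nonempty)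
    (hcl : ∀ v ∈ X, (∃ w, H.Adj v w) ∧ ∀ w, H.Adj v w → w ∈ X) :
    ∃ (u : W) (C : List W), (u :: C).Nodup ∧ (∀ x ∈ u :: C, x ∈ X) ∧
      ((u :: C) ++ (u :: C)).IsChain H.Adj ∧ ∀ w, H.Adj u w → w ∈ u :: C := by
  classical
  let p : ℕ → Prop := fun n => ∃ l : List W, l.length = n + 1 ∧ l.Nodup ∧ (∀ x ∈ l, x ∈ X) ∧
    l.IsChain H.Adj
  obtain ⟨v, hv⟩ := hX
  have h0 : p 0 := ⟨[v], rfl, by simp, by simpa using hv, List.isChain_singleton _⟩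
  have hbd : ∀ n, p n → n ≤ X.card := by
    rintro n ⟨l, hl, hnd, hlX, -⟩
    have : l.toFinset.card ≤ X.card := Finset.card_le_card fun x hx => hlX x (by simpa using hx)
    rw [List.toFinset_card_of_nodup hnd] at this
    omega
  obtain ⟨l, hlen, hnd, hlX, hch⟩ := Nat.findGreatest_spec (P := p) (Nat.zero_le X.card) h0
  have hmax : ¬ p (Nat.findGreatest p X.card + 1) := fun h =>
    absurd (Nat.le_findGreatest (hbd _ h) h) (by omega)
  obtain ⟨u, t, rfl⟩ := List.exists_cons_of_length_eq_add_one hlen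
  have hu : ∀ w, H.Adj u w → w ∈ u :: t := by
    intro w hw
    by_contra hwt
    refine hmax ⟨w :: u :: t, by rw [List.length_cons, hlen], List.nodup_cons.2 ⟨hwt, hnd⟩, ?_,
      List.isChain_cons_cons.2 ⟨hw.symm, hch⟩⟩
    intro x hx
    rcases List.mem_cons.1 hx with rfl | hx
    · exact (hcl u (hlX u List.mem_cons_self)).2 x hw
    · exact hlX x hx
  have hu' : ∀ w, H.Adj u w → w ∈ t := fun w hw => by
    rcases List.mem_cons.1 (hu w hw) with rfl | h
    · exact absurd hw (H.loopless.irrefl _)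
    · exact h
  obtain ⟨w, hw⟩ := (hcl u (hlX u List.mem_cons_self)).1
  obtain ⟨t₁, y, t₂, rfl, hy, hlast⟩ := exists_split_last (p := H.Adj u) ⟨w, hu' w hw, hw⟩
  have e : u :: (t₁ ++ y :: t₂) = (u :: (t₁ ++ [y])) ++ t₂ := by simp
  rw [e] at hnd hch hlX
  refine ⟨u, t₁ ++ [y], hnd.of_append_left, fun x hx => hlX x (List.mem_append_left _ hx), ?_, ?_⟩
  · have hc := (List.isChain_append.1 hch).1
    refine List.isChain_append.2 ⟨hc, hc, ?_⟩
    intro x hx z hz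
    rw [← List.cons_append, List.getLast?_append] at hx
    simp at hx hz
    subst hx hz
    exact hy.symm
  · intro x hx
    have := hu' x hx
    have := hlast x
    simp at *
    tauto

variable [Fintype W] [DecidableEq W]

/-- Greedy colouring along a list: if every vertex of the list has a neighbour later in the list
or equal to the uncoloured vertex `z`, then each vertex has at most two coloured neighbours when
its turn comes. -/
theorem ProperOn.greedy {H : SimpleGraph W} [DecidableRel H.Adj] (hdeg : ∀ v, H.degree v ≤ 3)
    (z : W) (l : List W) : ∀ {c : W → Fin 3} {Y : Set W}, ProperOn H c Y → z ∉ Y →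
      (∀ x ∈ l, x ∉ Y) → l.Nodup → z ∉ l →
      (∀ l₁ x l₂, l = l₁ ++ x :: l₂ → ∃ y ∈ l₂ ++ [z], H.Adj x y) →
      ∃ c' : W → Fin 3, ProperOn H c' (Y ∪ {x | x ∈ l}) ∧ ∀ y ∈ Y, c' y = c y := by
  induction l with
  | nil => intro c Y hc _ _ _ _ _; exact ⟨c, by simpa using hc, fun _ _ => rfl⟩
  | cons x l ih =>
    intro c Y hc hz hl hnd hzl hnext
    obtain ⟨y, hy, hxy⟩ := hnext [] x l rfl
    have hyY : y ∉ Y := by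
      rcases List.mem_append.1 hy with h | h
      · exact hl y (List.mem_cons_of_mem _ h)
      · rw [List.mem_singleton.1 h]; exact hz
    obtain ⟨c₁, h₁, h₁'⟩ := hc.exists_insert (v := x) (((H.neighborFinset x).erase y).image c)
      (by
        refine Finset.card_image_le.trans_lt ?_
        rw [Finset.card_erase_of_mem (by simpa using hxy), card_neighborFinset_eq_degree]
        have := hdeg x
        omega)
      (fun w hw _ hxw => Finset.mem_image_of_mem _ (Finset.mem_erase.2
        ⟨fun e => hyY (e ▸ hw), by simpa using hxw⟩))
    rw [List.nodup_cons] at hnd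
    obtain ⟨c₂, h₂, h₂'⟩ := ih h₁
      (by
        rintro (rfl | h)
        · exact hzl List.mem_cons_self
        · exact hz h)
      (by
        rintro w hw (rfl | h)
        · exact hnd.1 hw
        · exact hl w (List.mem_cons_of_mem _ hw) h)
      hnd.2 (fun h => hzl (List.mem_cons_of_mem _ h))
      (fun l₁ w l₂ e => hnext (x :: l₁) w l₂ (by rw [e]; rfl))
    refine ⟨c₂, h₂.mono ?_, fun w hw => ?_⟩
    · rintro w (h | h)
      · exact .inl (.inr h)
      · rcases List.mem_cons.1 h with rfl | h
        · exact .inl (.inl rfl)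
        · exact .inr h
    · rw [h₂' w (.inr hw), h₁' w]
      rintro rfl
      exact hl w List.mem_cons_self hw

/-- The colouring of `ProperOn.greedy` extends to `z` if `z` has two neighbours coloured alike
at the start. -/
theorem ProperOn.greedy_insert {H : SimpleGraph W} [DecidableRel H.Adj]
    (hdeg : ∀ v, H.degree v ≤ 3) (z : W) (l : List W) {c : W → Fin 3} {Y : Set W}
    (hc : ProperOn H c Y) (hz : z ∉ Y) (hl : ∀ x ∈ l, x ∉ Y) (hnd : l.Nodup) (hzl : z ∉ l)
    (hnext : ∀ l₁ x l₂, l = l₁ ++ x :: l₂ → ∃ y ∈ l₂ ++ [z], H.Adj x y)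
    {a b : W} (ha : a ∈ Y) (hb : b ∈ Y) (hab : a ≠ b) (hza : H.Adj z a) (hzb : H.Adj z b)
    (hcab : c a = c b) :
    ∃ c' : W → Fin 3, ProperOn H c' (insert z (Y ∪ {x | x ∈ l})) := by
  obtain ⟨c₁, h₁, h₁'⟩ := ProperOn.greedy hdeg z l hc hz hl hnd hzl hnext
  obtain ⟨c₂, h₂, -⟩ := h₁.exists_insert (v := z) (((H.neighborFinset z).erase a).image c₁)
    (by
      refine Finset.card_image_le.trans_lt ?_
      rw [Finset.card_erase_of_mem (by simpa using hza), card_neighborFinset_eq_degree]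
      have := hdeg z
      omega)
    (by
      intro w _ _ hzw
      by_cases hwa : w = a
      · subst hwa
        rw [h₁' w ha, hcab, ← h₁' b hb]
        exact Finset.mem_image_of_mem _ (Finset.mem_erase.2 ⟨hab.symm, by simpa using hzb⟩)
      · exact Finset.mem_image_of_mem _ (Finset.mem_erase.2 ⟨hwa, by simpa using hzw⟩))
  exact ⟨c₂, h₂⟩

/-- Colouring a set that is traversed by a path `a, v, b, …` with `a` and `b` not adjacent: these
two get the same colour, and `v` is coloured last. -/
theorem ProperOn.of_path {H : SimpleGraph W} [DecidableRel H.Adj] (hdeg : ∀ v, H.degree v ≤ 3)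
    {a v b m : W} {l : List W} (hnd : (a :: v :: b :: l).Nodup) (hav : H.Adj a v)
    (hch : (v :: b :: l).IsChain H.Adj) (hab : ¬ H.Adj a b) (hm : m ∈ l) (hvm : H.Adj v m) :
    ∃ c : W → Fin 3, ProperOn H c {x | x ∈ a :: v :: b :: l} := by
  obtain ⟨r₁, r₂, rfl⟩ := List.append_of_mem hm
  have hvb := (List.isChain_cons_cons.1 hch).1
  have hch' := List.isChain_append.1 (List.isChain_cons_cons.1 hch).2.tail
  -- The walk along `r₁` and the walk backwards along `r₂` both end next to `m`.
  have c₁ : (r₁ ++ [m]).IsChain H.Adj := by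
    rw [List.isChain_append]
    exact ⟨hch'.1, List.isChain_singleton _, fun x hx y hy => hch'.2.2 x hx y (by simpa using hy)⟩
  have c₂ : (r₂.reverse ++ [m]).IsChain H.Adj := by
    rw [← List.reverse_cons, List.isChain_reverse]
    exact hch'.2.1.imp fun _ _ h => h.symm
  obtain ⟨c', h'⟩ := ProperOn.greedy_insert (H := H) hdeg v (r₁ ++ (r₂.reverse ++ [m]))
    (c := fun _ => 0) (Y := {a, b})
    (by
      rintro x (rfl | rfl) y (rfl | rfl) hxy
      · exact absurd hxy (H.loopless.irrefl _)
      · exact absurd hxy hab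
      · exact absurd hxy.symm hab
      · exact absurd hxy (H.loopless.irrefl _))
    (by
      rintro (rfl | rfl)
      · exact H.loopless.irrefl _ hav
      · exact H.loopless.irrefl _ hvb)
    (by
      rintro x hx (rfl | rfl) <;> (simp at hnd hx; grind))
    (by
      have h := ((List.nodup_cons.1 (List.nodup_cons.1 (List.nodup_cons.1 hnd).2).2).2)
      refine (List.Perm.nodup_iff (List.Perm.append_left r₁ ?_)).1 h
      exact (List.perm_append_singleton m r₂.reverse).trans
        ((List.reverse_perm r₂).cons m) |>.symm)
    (by simp at hnd ⊢; grind)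
    (by
      intro l₁ x l₂ e
      rcases List.append_eq_append_iff.1 e with ⟨t, rfl, ht⟩ | ⟨t, rfl, ht⟩
      · rcases List.append_eq_append_iff.1 ht with ⟨t', rfl, ht'⟩ | ⟨t', ht₁, ht'⟩
        · have : t' = [] ∧ x = m ∧ l₂ = [] := by
            rcases t' with _ | ⟨y, t'⟩ <;> simp at ht' ⊢
            grind
          obtain ⟨rfl, rfl, rfl⟩ := this
          exact ⟨v, by simp, hvm.symm⟩
        · cases t' with
          | nil =>
            simp at ht'
            obtain ⟨rfl, rfl⟩ := ht'
            exact ⟨v, by simp, hvm.symm⟩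
          | cons y t' =>
            simp only [List.cons_append, List.cons.injEq] at ht'
            obtain ⟨rfl, rfl⟩ := ht'
            obtain ⟨y, hy, hxy⟩ := exists_adj_of_isChain c₂ _ _ _ ht₁
            exact ⟨y, by simp at hy ⊢; tauto, hxy⟩
      · cases t with
        | nil =>
          simp only [List.nil_append] at ht
          cases hr : r₂.reverse with
          | nil =>
            rw [hr] at ht
            simp at ht
            obtain ⟨rfl, rfl⟩ := ht
            exact ⟨v, by simp, hvm.symm⟩
          | cons y t =>
            rw [hr] at ht
            simp only [List.cons_append, List.cons.injEq] at ht
            obtain ⟨rfl, rfl⟩ := ht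
            obtain ⟨y, hy, hxy⟩ := exists_adj_of_isChain c₂ [] _ _ hr
            exact ⟨y, by simp at hy ⊢; tauto, hxy⟩
        | cons y t =>
          simp only [List.cons_append, List.cons.injEq] at ht
          obtain ⟨rfl, rfl⟩ := ht
          obtain ⟨y, hy, hxy⟩ := exists_adj_of_isChain c₁ _ _ _ rfl
          exact ⟨y, by simp at hy ⊢; tauto, hxy⟩)
    (a := a) (b := b) (by simp) (by simp) (by rintro rfl; simp at hnd) hav.symm hvb rfl
  refine ⟨c', h'.mono ?_⟩
  intro x hx
  simp at hx ⊢
  tauto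

/-- **Brooks' theorem** for maximum degree three: without a complete subgraph on four vertices,
three colours suffice. -/
theorem exists_properOn_three {H : SimpleGraph W} [DecidableRel H.Adj]
    (hdeg : ∀ v, H.degree v ≤ 3)
    (hK : ∀ a b c d, H.Adj a b → H.Adj a c → H.Adj a d → H.Adj b c → H.Adj b d → ¬ H.Adj c d)
    (X : Finset W) : ∃ c : W → Fin 3, ProperOn H c X := by
  classical
  induction X using Finset.strongInduction with
  | H X ih =>
  by_cases hlow : ∃ v ∈ X, ∃ B : Finset W, B.card ≤ 2 ∧ ∀ y ∈ X, H.Adj v y → y ∈ B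
  · obtain ⟨v, hv, B, hB, hvB⟩ := hlow
    obtain ⟨c, hc⟩ := ih (X.erase v) (Finset.erase_ssubset hv)
    obtain ⟨c', hc', -⟩ := hc.exists_insert (v := v) (B.image c)
      (Finset.card_image_le.trans_lt (by omega))
      (fun y hy _ hvy => Finset.mem_image_of_mem _ (hvB y (Finset.mem_of_mem_erase hy) hvy))
    refine ⟨c', hc'.mono fun x hx => ?_⟩
    by_cases h : x = v
    · exact .inl h
    · exact .inr (Finset.mem_erase.2 ⟨h, hx⟩)
  push Not at hlow
  have hcl : ∀ v ∈ X, ∀ w, H.Adj v w → w ∈ X := by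
    intro v hv w hw
    by_contra hwX
    obtain ⟨y, hy, hvy, hyB⟩ := hlow v hv ((H.neighborFinset v).erase w)
      (by
        rw [Finset.card_erase_of_mem (by simpa using hw), card_neighborFinset_eq_degree]
        have := hdeg v
        omega)
    exact hyB (Finset.mem_erase.2 ⟨fun e => hwX (e ▸ hy), by simpa using hvy⟩)
  rcases X.eq_empty_or_nonempty with rfl | hX
  · exact ⟨fun _ => 0, fun x hx => absurd hx (by simp)⟩
  obtain ⟨u, C, hnd, hCX, hch, hu⟩ := exists_cycle_list hX fun v hv =>
    ⟨by obtain ⟨y, -, hvy, -⟩ := hlow v hv ∅ (by simp); exact ⟨y, hvy⟩, hcl v hv⟩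
  have hsub : (u :: C).toFinset ⊆ X := fun x hx => hCX x (List.mem_toFinset.1 hx)
  by_cases hout : ∃ k ∈ C, ∃ w, H.Adj k w ∧ w ∉ u :: C
  · -- Some vertex `k` of the cycle has a neighbour `w` outside, and its predecessor `s` has none.
    -- Then `s` takes the colour of `w`, and the cycle is coloured backwards from `s` down to `k`.
    obtain ⟨A, s, k, B, e, hs, w, hkw, hw⟩ := exists_split_step
      (p := fun k => ∃ w, H.Adj k w ∧ w ∉ u :: C) (a := u)
      (by rintro ⟨w, h₁, h₂⟩; exact h₂ (hu w h₁)) hout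
    push Not at hs
    rw [e] at hnd hch hs hw hCX
    obtain ⟨c, hc⟩ := ih (X \ (u :: C).toFinset)
      (Finset.sdiff_ssubset hsub ⟨u, by simp⟩)
    rw [e] at hc
    have hsk : H.Adj s k := by
      have := (List.isChain_append.1 (List.isChain_append.1 hch).1).2.1
      exact (List.isChain_cons_cons.1 this).1
    have hwX : w ∈ X := hcl k (hCX k (by simp)) w hkw
    have hchain : (A.reverse ++ B.reverse ++ [k]).IsChain H.Adj := by
      have h1 : (k :: B ++ A).IsChain H.Adj := by
        refine hch.infix ⟨A ++ [s], s :: k :: B, by simp⟩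
      rw [← List.isChain_reverse] at h1
      simp only [List.cons_append, List.reverse_cons, List.reverse_append] at h1
      exact h1.imp fun _ _ h => h.symm
    obtain ⟨c₁, h₁, h₁s, h₁'⟩ := hc.exists_union (F := {s}) (fun _ => c w)
      (by rintro x rfl y rfl h; exact absurd h (H.loopless.irrefl _))
      (by
        rintro x rfl y hy hyx hxy
        have hyC := hs y hxy
        simp only [Finset.coe_sdiff, Set.mem_sdiff, Finset.mem_coe, List.mem_toFinset] at hy
        exact absurd hyC hy.2)
    have hws : w ≠ s := by rintro rfl; simp at hw
    simp only [List.mem_append, List.mem_cons, not_or] at hw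
    have hnd' := hnd
    simp only [List.nodup_append, List.nodup_cons, List.mem_cons, not_or] at hnd'
    obtain ⟨c₂, h₂⟩ := h₁.greedy_insert hdeg k (A.reverse ++ B.reverse)
      (by
        simp only [Finset.coe_sdiff, Set.mem_union, Set.mem_sdiff, Finset.mem_coe,
          List.mem_toFinset, Set.mem_singleton_iff]
        rintro (h | rfl)
        · exact h.2 (by simp)
        · exact H.loopless.irrefl _ hsk)
      (by
        intro x hx
        simp only [List.mem_append, List.mem_reverse] at hx
        simp only [Finset.coe_sdiff, Set.mem_union, Set.mem_sdiff, Finset.mem_coe,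
          List.mem_toFinset, Set.mem_singleton_iff]
        rintro (h | rfl)
        · exact h.2 (by simp; tauto)
        · rcases hx with hx | hx
          · exact hnd'.2.2 x hx x (.inl rfl) rfl
          · exact hnd'.2.1.1.2 hx)
      (by
        rw [List.nodup_append]
        refine ⟨by simpa using hnd'.1, by simpa using hnd'.2.1.2.2, ?_⟩
        intro a ha b hb
        exact hnd'.2.2 a (by simpa using ha) b (.inr (.inr (by simpa using hb))))
      (by
        simp only [List.mem_append, List.mem_reverse, not_or]
        exact ⟨fun h => hnd'.2.2 k h k (.inr (.inl rfl)) rfl, hnd'.2.1.2.1⟩)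
      (exists_adj_of_isChain hchain) (a := w) (b := s)
      (by
        refine .inl ?_
        simp only [Finset.coe_sdiff, Set.mem_sdiff, Finset.mem_coe, List.mem_toFinset]
        exact ⟨hwX, by simp; tauto⟩)
      (by simp) hws hkw hsk.symm
      (by rw [h₁s s rfl, h₁' w hws])
    refine ⟨c₂, h₂.mono fun x hx => ?_⟩
    simp only [Finset.coe_sdiff, Set.mem_insert_iff, Set.mem_union, Set.mem_sdiff, Finset.mem_coe,
      List.mem_toFinset, Set.mem_singleton_iff, List.mem_append, List.mem_cons, List.mem_reverse,
      Set.mem_ofPred_eq] at hx ⊢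
    tauto
  push Not at hout
  have hclC : ∀ k ∈ u :: C, ∀ w, H.Adj k w → w ∈ u :: C := by
    intro k hk w hw
    rcases List.mem_cons.1 hk with rfl | hk
    · exact hu w hw
    · exact hout k hk w hw
  by_cases hall : (u :: C).toFinset = X
  swap
  · obtain ⟨c, hc⟩ := ih _ (Finset.ssubset_iff_subset_ne.2 ⟨hsub, hall⟩)
    obtain ⟨c', hc'⟩ := ih (X \ (u :: C).toFinset) (Finset.sdiff_ssubset hsub ⟨u, by simp⟩)
    obtain ⟨c'', h'', -⟩ := hc'.exists_union c hc
      (by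
        intro x hx y _ hyC hxy
        simp only [Finset.mem_coe, List.mem_toFinset] at hx hyC
        exact absurd (hclC x hx y hxy) hyC)
    refine ⟨c'', h''.mono fun x hx => ?_⟩
    by_cases h : x ∈ (u :: C).toFinset
    · exact .inr h
    · exact .inl (by simpa using ⟨hx, by simpa using h⟩)
  -- The cycle now passes through all of `X`. Around it there are two vertices at distance two
  -- along the cycle that are not adjacent.
  have hthree : ∀ v ∈ X, ∀ a b, ∃ m ∈ X, H.Adj v m ∧ m ≠ a ∧ m ≠ b := by
    intro v hv a b
    obtain ⟨m, hm, hvm, hmB⟩ := hlow v hv {a, b} Finset.card_le_two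
    exact ⟨m, hm, hvm, by simpa using hmB⟩
  have hmem : ∀ x, x ∈ X ↔ x ∈ u :: C := fun x => by rw [← hall, List.mem_toFinset]
  have hpath : ∀ (a v b : W) (l : List W), (a :: v :: b :: l).Nodup → H.Adj a v →
      (v :: b :: l).IsChain H.Adj → ¬ H.Adj a b → (∀ x, x ∈ X ↔ x ∈ a :: v :: b :: l) →
      ∃ c : W → Fin 3, ProperOn H c X := by
    intro a v b l hnd hav hch hab hmem
    obtain ⟨m, hm, hvm, hma, hmb⟩ := hthree v ((hmem v).2 (by simp)) a b
    have hml : m ∈ l := by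
      have := (hmem m).1 hm
      have := hvm.ne'
      simp at *
      tauto
    obtain ⟨c, hc⟩ := ProperOn.of_path hdeg hnd hav hch hab hml hvm
    exact ⟨c, hc.mono fun x hx => (hmem x).1 hx⟩
  obtain ⟨m₁, hm₁, hum₁, -⟩ := hthree u ((hmem u).2 (by simp)) u u
  obtain ⟨m₂, hm₂, hum₂, hne₂, -⟩ := hthree u ((hmem u).2 (by simp)) m₁ m₁
  obtain ⟨m₃, hm₃, hum₃, hne₃, hne₃'⟩ := hthree u ((hmem u).2 (by simp)) m₁ m₂
  have hX4 : 4 ≤ (u :: C).length := by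
    have h4 : ({u, m₁, m₂, m₃} : Finset W).card ≤ (u :: C).toFinset.card :=
      Finset.card_le_card (by
        intro x hx
        rw [hall]
        simp only [Finset.mem_insert, Finset.mem_singleton] at hx
        rcases hx with rfl | rfl | rfl | rfl
        · exact (hmem x).2 (by simp)
        all_goals assumption)
    rw [List.toFinset_card_of_nodup hnd] at h4
    have : ({u, m₁, m₂, m₃} : Finset W).card = 4 := by
      rw [Finset.card_insert_of_notMem, Finset.card_insert_of_notMem,
        Finset.card_insert_of_notMem, Finset.card_singleton]
      · simpa using hne₃'.symm
      · simpa using ⟨hne₂.symm, hne₃.symm⟩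
      · simpa using ⟨hum₁.ne, hum₂.ne, hum₃.ne⟩
    omega
  obtain ⟨v, b, d, R, rfl⟩ : ∃ v b d R, C = v :: b :: d :: R := by
    rcases C with _ | ⟨v, _ | ⟨b, _ | ⟨d, R⟩⟩⟩
    · simp at hX4
    · simp at hX4
    · simp at hX4
    · exact ⟨v, b, d, R, rfl⟩
  have huv : H.Adj u v := (List.isChain_cons_cons.1 hch).1
  have hch1 : (v :: b :: d :: R).IsChain H.Adj := (List.isChain_append.1 hch).1.tail
  by_cases hub : H.Adj u b
  swap
  · exact hpath u v b (d :: R) hnd huv hch1 hub hmem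
  have hvb : H.Adj v b := (List.isChain_cons_cons.1 hch1).1
  have hbd : H.Adj b d := (List.isChain_cons_cons.1 (List.isChain_cons_cons.1 hch1).2).1
  cases R with
  | nil =>
    -- A 4-cycle whose vertices have degree three inside it is a complete graph.
    exfalso
    have hfour : ∀ x y z t, (∀ w, w ∈ X → w = x ∨ w = y ∨ w = z ∨ w = t) → x ∈ X → H.Adj x t := by
      intro x y z t h hx
      obtain ⟨m, hm, hxm, h₁, h₂⟩ := hthree x hx y z
      rcases h m hm with rfl | rfl | rfl | rfl
      · exact absurd hxm (H.loopless.irrefl _)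
      · exact absurd rfl h₁
      · exact absurd rfl h₂
      · exact hxm
    refine hK u v b d huv hub ?_ hvb ?_ hbd
    · exact hfour u v b d (fun w hw => by simpa using (hmem w).1 hw) ((hmem u).2 (by simp))
    · exact hfour v u b d (fun w hw => by have := (hmem w).1 hw; simp at this; tauto)
        ((hmem v).2 (by simp))
  | cons e R =>
    refine hpath b d e (R ++ [u, v]) ?_ hbd ?_ ?_ ?_
    · refine (List.Perm.nodup_iff ?_).1 hnd
      exact (List.perm_append_comm (l₁ := [u, v]) (l₂ := b :: d :: e :: R))
    · exact hch.infix ⟨[u, v, b], b :: d :: e :: R, by simp⟩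
    · intro hbe
      -- Otherwise `b` is adjacent to the four vertices `v`, `d`, `u`, `e`.
      have h4 : ({v, d, u, e} : Finset W).card ≤ (H.neighborFinset b).card :=
        Finset.card_le_card (by
          intro x hx
          simp only [Finset.mem_insert, Finset.mem_singleton] at hx
          rw [mem_neighborFinset]
          rcases hx with rfl | rfl | rfl | rfl
          · exact hvb.symm
          · exact hbd
          · exact hub.symm
          · exact hbe)
      have : ({v, d, u, e} : Finset W).card = 4 := by
        simp at hnd
        rw [Finset.card_insert_of_notMem, Finset.card_insert_of_notMem,
          Finset.card_insert_of_notMem, Finset.card_singleton] <;> simp <;> grind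
      rw [card_neighborFinset_eq_degree] at h4
      have := hdeg b
      omega
    · intro x
      rw [hmem]
      simp
      tauto

/-- Moving one vertex changes a symmetric double sum only in the terms at that vertex. -/
theorem sum_sum_eq_add_two_mul (s : W → W → ℤ) (hs : ∀ v u, s v u = s u v) (x : W)
    (hx : s x x = 0) : ∑ v, ∑ u, s v u =
      ∑ v ∈ Finset.univ.erase x, ∑ u ∈ Finset.univ.erase x, s v u + 2 * ∑ u, s x u := by
  have h1 : ∀ v, ∑ u, s v u = ∑ u ∈ Finset.univ.erase x, s v u + s v x := fun v =>
    (Finset.sum_erase_add _ _ (Finset.mem_univ x)).symm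
  have h2 : ∑ v, s v x = ∑ u, s x u := Finset.sum_congr rfl fun v _ => hs v x
  rw [← Finset.sum_erase_add _ _ (Finset.mem_univ x)]
  rw [Finset.sum_congr rfl fun v _ => h1 v, Finset.sum_add_distrib]
  rw [← Finset.sum_erase_add _ _ (Finset.mem_univ x), hx] at h2
  linarith

/-- **Lovász's decomposition theorem**: if every degree is less than `∑ i, (d i + 1)`, the vertices
split into parts such that a vertex of the `i`-th part has at most `d i` neighbours there. A
partition minimising the number of edges inside the parts, corrected by the weights `d`, works. -/
theorem exists_lovasz_partition {ι : Type*} [Fintype ι] [DecidableEq ι] [Nonempty ι]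
    (H : SimpleGraph W) [DecidableRel H.Adj] (d : ι → ℕ)
    (hdeg : ∀ v, H.degree v < ∑ i, (d i + 1)) :
    ∃ g : W → ι, ∀ v, ((H.neighborFinset v).filter (g · = g v)).card ≤ d (g v) := by
  let s : (W → ι) → W → W → ℤ := fun g v u => if H.Adj v u ∧ g u = g v then 1 else 0
  obtain ⟨g, hg⟩ := Finite.exists_min fun g : W → ι => ∑ v, ∑ u, s g v u - 2 * ∑ v, (d (g v) : ℤ)
  refine ⟨g, fun x => ?_⟩
  by_contra! hx
  -- Some part contains at most `d j` neighbours of `x`; moving `x` there lowers the sum.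
  obtain ⟨j, hj⟩ : ∃ j, ((H.neighborFinset x).filter (g · = j)).card ≤ d j := by
    by_contra! hlt
    have h1 : ∑ i, (d i + 1) ≤ ∑ i, ((H.neighborFinset x).filter (g · = i)).card :=
      Finset.sum_le_sum fun i _ => hlt i
    rw [← Finset.card_eq_sum_card_fiberwise (fun _ _ => Finset.mem_coe.2 (Finset.mem_univ _)),
      card_neighborFinset_eq_degree] at h1
    exact absurd (hdeg x) (by omega)
  have hne : j ≠ g x := by rintro rfl; omega
  have hsum : ∀ h : W → ι, ∑ u, s h x u = ((H.neighborFinset x).filter (h · = h x)).card := by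
    intro h
    rw [Finset.sum_boole]
    congr 2
    ext u
    simp
  have hsym : ∀ h v u, s h v u = s h u v := fun h v u => by
    simp only [s, H.adj_comm v u, eq_comm (a := h u)]
  have hirr : ∀ h, s h x x = 0 := fun h => by simp [s]
  have hmin := hg (Function.update g x j)
  rw [sum_sum_eq_add_two_mul (s g) (hsym g) x (hirr g),
    sum_sum_eq_add_two_mul (s (Function.update g x j)) (hsym _) x (hirr _),
    hsum, hsum] at hmin
  have e1 : ∑ v ∈ Finset.univ.erase x, ∑ u ∈ Finset.univ.erase x, s (Function.update g x j) v u =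
      ∑ v ∈ Finset.univ.erase x, ∑ u ∈ Finset.univ.erase x, s g v u :=
    Finset.sum_congr rfl fun v hv => Finset.sum_congr rfl fun u hu => by
      simp only [s, Function.update_of_ne (Finset.ne_of_mem_erase hv),
        Function.update_of_ne (Finset.ne_of_mem_erase hu)]
  have e2 : (H.neighborFinset x).filter
      (fun u => Function.update g x j u = Function.update g x j x) =
      (H.neighborFinset x).filter (g · = j) :=
    Finset.filter_congr fun u hu => by
      rw [Function.update_self, Function.update_of_ne]
      rintro rfl
      simp at hu
  have e3 : ∑ v ∈ Finset.univ.erase x, (d (Function.update g x j v) : ℤ) =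
      ∑ v ∈ Finset.univ.erase x, (d (g v) : ℤ) :=
    Finset.sum_congr rfl fun v hv => by rw [Function.update_of_ne (Finset.ne_of_mem_erase hv)]
  have e4 := Finset.sum_erase_add Finset.univ (fun v => (d (g v) : ℤ)) (Finset.mem_univ x)
  have e5 := Finset.sum_erase_add Finset.univ (fun v => (d (Function.update g x j v) : ℤ))
    (Finset.mem_univ x)
  simp only [Function.update_self] at e5
  rw [e1, e2, ← e4, ← e5, e3] at hmin
  omega

/-- A graph of maximum degree at most eight without a complete subgraph on four vertices is
7-colourable: it splits into an independent set and two parts of maximum degree three. -/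
theorem colorable_seven_of_degree_le_eight (H : SimpleGraph W) [DecidableRel H.Adj]
    (hdeg : ∀ v, H.degree v ≤ 8)
    (hK : ∀ a b c d, H.Adj a b → H.Adj a c → H.Adj a d → H.Adj b c → H.Adj b d → ¬ H.Adj c d) :
    H.Colorable 7 := by
  classical
  obtain ⟨g, hg⟩ := exists_lovasz_partition (ι := Fin 3) H ![0, 3, 3] fun v =>
    (hdeg v).trans_lt (by decide)
  let H' : SimpleGraph W :=
    { Adj := fun x y => H.Adj x y ∧ g x = g y
      symm := ⟨fun _ _ h => ⟨h.1.symm, h.2.symm⟩⟩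
      loopless := ⟨fun x h => H.loopless.irrefl x h.1⟩ }
  have hH' : ∀ x, H'.degree x ≤ ![0, 3, 3] (g x) := by
    intro x
    refine le_trans (Finset.card_le_card fun y hy => ?_) (hg x)
    rw [mem_neighborFinset] at hy
    simpa using ⟨hy.1, hy.2.symm⟩
  have hle : ∀ i : Fin 3, ![0, 3, 3] i ≤ 3 := by decide
  obtain ⟨c, hc⟩ := exists_properOn_three (H := H') (fun v => (hH' v).trans (hle _))
    (fun a b c d h₁ h₂ h₃ h₄ h₅ h₆ => hK a b c d h₁.1 h₂.1 h₃.1 h₄.1 h₅.1 h₆.1) Finset.univ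
  refine ⟨Coloring.mk (fun x => ![0, (c x).castLE (by omega) + 1, (c x).castLE (by omega) + 4] (g x))
    ?_⟩
  intro x y hxy hcol
  by_cases h : g x = g y
  · have hxy' : H'.Adj x y := ⟨hxy, h⟩
    by_cases h0 : g x = 0
    · have := hH' x
      rw [h0] at this
      have hpos : 0 < H'.degree x := (H'.degree_pos_iff_exists_adj x).2 ⟨y, hxy'⟩
      simp at this
      omega
    · have := hc x (by simp) y (by simp) hxy'
      rw [h] at h0 hcol
      revert this h0 hcol
      generalize c x = a
      generalize c y = b
      generalize g y = i
      revert a b i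
      decide
  · revert h hcol
    generalize c x = a
    generalize c y = b
    generalize g y = i
    generalize g x = j
    revert a b i j
    decide

end Brooks

/-! ### The conflict graph -/

section Conflict

variable {V : Type*}

/-- The conflict graph of `G`. Two edges are in conflict when they are the end edges of a walk
`u, x, y, v` of three edges without backtracking; the case `u = v` covers the pairs of edges of a
triangle. Its vertices are all unordered pairs; those that are not edges of `G` are isolated. -/
def conflictGraph (G : SimpleGraph V) : SimpleGraph (Sym2 V) where
  Adj e f := ∃ u x y v, e = s(u, x) ∧ f = s(y, v) ∧ G.Adj u x ∧ G.Adj x y ∧ G.Adj y v ∧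
    u ≠ y ∧ x ≠ v
  symm := ⟨by
    rintro e f ⟨u, x, y, v, rfl, rfl, h₁, h₂, h₃, h₄, h₅⟩
    exact ⟨v, y, x, u, Sym2.eq_swap, Sym2.eq_swap, h₃.symm, h₂.symm, h₁.symm, h₅.symm, h₄.symm⟩⟩
  loopless := ⟨by
    rintro e ⟨u, x, y, v, rfl, h, h₁, h₂, h₃, h₄, h₅⟩
    rcases Sym2.eq_iff.1 h with ⟨h, -⟩ | ⟨-, h⟩
    · exact h₄ h
    · exact h₂.ne h⟩

variable {G : SimpleGraph V}

theorem conflictGraph_adj_of_walk {u x y v : V} (h₁ : G.Adj u x) (h₂ : G.Adj x y)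
    (h₃ : G.Adj y v) (h₄ : u ≠ y) (h₅ : x ≠ v) : (conflictGraph G).Adj s(u, x) s(y, v) :=
  ⟨u, x, y, v, rfl, rfl, h₁, h₂, h₃, h₄, h₅⟩

theorem exists_of_conflictGraph_adj {u v : V} {f : Sym2 V}
    (h : (conflictGraph G).Adj s(u, v) f) :
    (∃ a b, G.Adj u a ∧ a ≠ v ∧ G.Adj a b ∧ b ≠ u ∧ f = s(a, b)) ∨
      ∃ a b, G.Adj v a ∧ a ≠ u ∧ G.Adj a b ∧ b ≠ v ∧ f = s(a, b) := by
  obtain ⟨p, x, y, q, e, rfl, h₁, h₂, h₃, h₄, h₅⟩ := h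
  rcases Sym2.eq_iff.1 e with ⟨rfl, rfl⟩ | ⟨rfl, rfl⟩
  · exact .inr ⟨y, q, h₂, h₄.symm, h₃, h₅.symm, rfl⟩
  · exact .inl ⟨y, q, h₂, h₄.symm, h₃, h₅.symm, rfl⟩

theorem exists_adj_of_conflictGraph_adj {e f : Sym2 V} (h : (conflictGraph G).Adj e f) :
    ∃ u v, e = s(u, v) ∧ G.Adj u v := by
  obtain ⟨u, x, y, v, rfl, -, h, -⟩ := h
  exact ⟨u, x, rfl, h⟩

theorem conflictGraph_adj_of_edgeEDist_eq_one {e f : G.edgeSet} (h : G.edgeEDist e f = 1) :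
    (conflictGraph G).Adj e f := by
  have hlt : G.edgeEDist e f < 2 := by rw [h]; exact Nat.one_lt_ofNat
  have hdisj : ∀ x, x ∈ (e : Sym2 V) → x ∉ (f : Sym2 V) := by
    intro x hx hx'
    have : G.edgeEDist e f ≤ G.edist x x := iInf₂_le_of_le x hx (iInf₂_le x hx')
    rw [h, edist_self] at this
    simp at this
  simp only [edgeEDist, iInf_lt_iff] at hlt
  obtain ⟨x, hx, y, hy, hxy⟩ := hlt
  have hne : x ≠ y := fun e => hdisj x hx (e ▸ hy)
  have hadj : G.Adj x y := by
    rw [← edist_eq_one_iff_adj]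
    refine le_antisymm (Order.le_of_lt_add_one (by rw [one_add_one_eq_two]; exact hxy)) ?_
    rw [Order.one_le_iff_ne_zero]
    exact fun h0 => hne (edist_eq_zero_iff.1 h0)
  obtain ⟨u, hu⟩ := Sym2.mem_iff_exists.1 hx
  obtain ⟨v, hv⟩ := Sym2.mem_iff_exists.1 hy
  have he : G.Adj x u := by have := e.2; rwa [hu] at this
  have hf : G.Adj y v := by have := f.2; rwa [hv] at this
  rw [hu, hv, Sym2.eq_swap (a := x)]
  refine conflictGraph_adj_of_walk he.symm hadj hf ?_ ?_
  · rintro rfl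
    exact hdisj u (by rw [hu]; simp) hy
  · rintro rfl
    exact hdisj x hx (by rw [hv]; simp)

theorem conflictGraph_adj_of_inCommonTriangle {e f : G.edgeSet} (hne : e ≠ f)
    (h : G.InCommonTriangle e f) : (conflictGraph G).Adj e f := by
  classical
  obtain ⟨⟨e, he⟩, ⟨f, hf⟩⟩ := e, f
  obtain ⟨t, ht, h₁, h₂⟩ := h
  induction e with | _ p q
  induction f with | _ r s
  have hp := h₁ p (by simp)
  have hq := h₁ q (by simp)
  have hr := h₂ r (by simp)
  have hs := h₂ s (by simp)
  have hne' : s(p, q) ≠ s(r, s) := fun e => hne (Subtype.ext e)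
  -- Two distinct edges of the triangle share a vertex `z`, and their other ends are adjacent.
  have key : ∀ x y z : V, x ∈ t → y ∈ t → x ≠ y → G.Adj z x → G.Adj z y →
      (conflictGraph G).Adj s(x, z) s(y, z) := fun x y z hx hy hxy h₁ h₂ => by
    rw [Sym2.eq_swap (a := x)]
    exact conflictGraph_adj_of_walk h₁ (ht.isClique hx hy hxy) h₂.symm h₂.ne h₁.ne'
  have he : G.Adj p q := he
  have hf : G.Adj r s := hf
  change (conflictGraph G).Adj s(p, q) s(r, s)
  by_cases hpr : p = r
  · subst hpr
    rw [Sym2.eq_swap, Sym2.eq_swap (a := p)]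
    exact key q s p hq hs (fun e => hne' (by rw [e])) he hf
  by_cases hps : p = s
  · subst hps
    rw [Sym2.eq_swap]
    exact key q r p hq hr (fun e => hne' (by rw [e, Sym2.eq_swap])) he hf.symm
  by_cases hqr : q = r
  · subst hqr
    rw [Sym2.eq_swap (a := q) (b := s)]
    exact key p s q hp hs hps he.symm hf
  by_cases hqs : q = s
  · subst hqs
    exact key p r q hp hr hpr he.symm hf.symm
  have h4 : ({p, q, r, s} : Finset V).card ≤ t.card := Finset.card_le_card fun x hx => by
    simp only [Finset.mem_insert, Finset.mem_singleton] at hx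
    rcases hx with rfl | rfl | rfl | rfl <;> assumption
  rw [ht.card_eq, Finset.card_insert_of_notMem, Finset.card_insert_of_notMem,
    Finset.card_pair hf.ne] at h4
  · omega
  · simpa using ⟨hqr, hqs⟩
  · simpa using ⟨he.ne, hpr, hps⟩

/-- A proper colouring of the conflict graph is an injective edge colouring. -/
theorem injChromaticIndex_le_of_colorable {n : ℕ} (h : (conflictGraph G).Colorable n) :
    G.injChromaticIndex ≤ n := by
  obtain ⟨C⟩ := h
  refine iInf₂_le n ⟨fun e => C e, fun e f hne h => C.valid ?_⟩
  rcases h with h | h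
  · exact conflictGraph_adj_of_edgeEDist_eq_one h
  · exact conflictGraph_adj_of_inCommonTriangle hne h

/-- A colouring of the edges outside `W` extends to the whole graph if colours for the edges at
`W` are found that avoid all conflicts. -/
theorem colorable_of_extension {W : Finset V} {c : Sym2 V → Fin 7}
    (hc : ProperOn (conflictGraph G) c {e | ∀ w ∈ W, w ∉ e}) (c' : Sym2 V → Fin 7)
    (h₁ : ∀ e, (∀ w ∈ W, w ∉ e) → c' e = c e)
    (h₂ : ∀ w ∈ W, ∀ x, G.Adj w x → ∀ f, (conflictGraph G).Adj s(w, x) f → c' s(w, x) ≠ c' f) :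
    (conflictGraph G).Colorable 7 := by
  refine ⟨Coloring.mk c' fun {e f} hef => ?_⟩
  have key : ∀ e f, (conflictGraph G).Adj e f → (∃ w ∈ W, w ∈ e) → c' e ≠ c' f := by
    rintro e f hef ⟨w, hw, hwe⟩
    obtain ⟨u, v, rfl, huv⟩ := exists_adj_of_conflictGraph_adj hef
    rcases Sym2.mem_iff.1 hwe with rfl | rfl
    · exact h₂ w hw v huv f hef
    · rw [Sym2.eq_swap] at hef ⊢
      exact h₂ w hw u huv.symm f hef
  by_cases he : ∃ w ∈ W, w ∈ e
  · exact key e f hef he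
  by_cases hf : ∃ w ∈ W, w ∈ f
  · exact (key f e hef.symm hf).symm
  push Not at he hf
  rw [h₁ e he, h₁ f hf]
  exact hc e he f hf hef

/-! ### Neighbourhoods in the conflict graph of a subcubic graph -/

variable [Fintype V] [DecidableEq V] [DecidableRel G.Adj]

variable (G) in
/-- The edges at `w` other than `wv`. -/
def edgesAt (w v : V) : Finset (Sym2 V) :=
  ((G.neighborFinset w).erase v).image fun x => s(w, x)

variable (G) in
/-- The edges in conflict with `wv` because of an edge at `w`. -/
def conflictsVia (w v : V) : Finset (Sym2 V) :=
  ((G.neighborFinset w).erase v).biUnion fun a => edgesAt G a w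

theorem mem_edgesAt {w v x : V} (h : G.Adj w x) (hx : x ≠ v) : s(w, x) ∈ edgesAt G w v :=
  Finset.mem_image_of_mem _ (by simpa using ⟨hx, h⟩)

theorem mem_conflictsVia {w v a x : V} (h : G.Adj w a) (ha : a ≠ v) (hax : G.Adj a x)
    (hx : x ≠ w) : s(a, x) ∈ conflictsVia G w v :=
  Finset.mem_biUnion.2 ⟨a, by simpa using ⟨ha, h⟩, mem_edgesAt hax hx⟩

theorem card_edgesAt_le (hdeg : ∀ v, G.degree v ≤ 3) {w v : V} (h : G.Adj w v) :
    (edgesAt G w v).card ≤ 2 := by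
  refine Finset.card_image_le.trans ?_
  rw [Finset.card_erase_of_mem (by simpa using h), card_neighborFinset_eq_degree]
  have := hdeg w
  omega

theorem card_conflictsVia_le (hdeg : ∀ v, G.degree v ≤ 3) {w v : V} (h : G.Adj w v) :
    (conflictsVia G w v).card ≤ (G.degree w - 1) * 2 := by
  refine (Finset.card_biUnion_le_card_mul _ _ 2 fun a ha => card_edgesAt_le hdeg ?_).trans ?_
  · exact ((mem_neighborFinset _ _ _).1 (Finset.mem_of_mem_erase ha)).symm
  · rw [Finset.card_erase_of_mem (by simpa using h), card_neighborFinset_eq_degree]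

theorem card_conflictsVia_le_four (hdeg : ∀ v, G.degree v ≤ 3) {w v : V} (h : G.Adj w v) :
    (conflictsVia G w v).card ≤ 4 := by
  have := card_conflictsVia_le hdeg h
  have := hdeg w
  omega

theorem mem_conflictsVia_union {u v : V} {f : Sym2 V} (h : (conflictGraph G).Adj s(u, v) f) :
    f ∈ conflictsVia G u v ∪ conflictsVia G v u := by
  rcases exists_of_conflictGraph_adj h with ⟨a, b, h₁, h₂, h₃, h₄, rfl⟩ | ⟨a, b, h₁, h₂, h₃, h₄, rfl⟩
  · exact Finset.mem_union_left _ (mem_conflictsVia h₁ h₂ h₃ h₄)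
  · exact Finset.mem_union_right _ (mem_conflictsVia h₁ h₂ h₃ h₄)

theorem degree_conflictGraph_le [DecidableRel (conflictGraph G).Adj]
    (hdeg : ∀ v, G.degree v ≤ 3) (e : Sym2 V) : (conflictGraph G).degree e ≤ 8 := by
  by_contra! hlt
  obtain ⟨f, hf⟩ := ((conflictGraph G).degree_pos_iff_exists_adj e).1 (by omega)
  obtain ⟨u, v, rfl, huv⟩ := exists_adj_of_conflictGraph_adj hf
  have h1 : (conflictGraph G).degree s(u, v) ≤ (conflictsVia G u v ∪ conflictsVia G v u).card :=
    Finset.card_le_card fun f hf => mem_conflictsVia_union (by simpa using hf)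
  have h2 := Finset.card_union_le (conflictsVia G u v) (conflictsVia G v u)
  have h3 := card_conflictsVia_le_four hdeg huv
  have h4 := card_conflictsVia_le_four hdeg huv.symm
  omega

theorem exists_third_neighbor (hdeg : ∀ v, G.degree v ≤ 3) {v a b : V} (ha : G.Adj v a)
    (hb : G.Adj v b) (hab : a ≠ b) : ∃ c, ∀ x, G.Adj v x → x = a ∨ x = b ∨ x = c := by
  by_contra! h
  obtain ⟨c, hc, hca, hcb, -⟩ := h a
  obtain ⟨d, hd, hda, hdb, hdc⟩ := h c
  have h4 : ({a, b, c, d} : Finset V).card ≤ (G.neighborFinset v).card :=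
    Finset.card_le_card fun x hx => by
      simp only [Finset.mem_insert, Finset.mem_singleton] at hx
      rw [mem_neighborFinset]
      rcases hx with rfl | rfl | rfl | rfl <;> assumption
  have : ({a, b, c, d} : Finset V).card = 4 := by
    rw [Finset.card_insert_of_notMem, Finset.card_insert_of_notMem,
      Finset.card_insert_of_notMem, Finset.card_singleton] <;> simp <;> grind
  rw [card_neighborFinset_eq_degree] at h4
  have := hdeg v
  omega

theorem eq_of_three_neighbors (hdeg : ∀ v, G.degree v ≤ 3) {v a b c : V} (ha : G.Adj v a)
    (hb : G.Adj v b) (hc : G.Adj v c) (hab : a ≠ b) (hac : a ≠ c) (hbc : b ≠ c) (x : V)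
    (hx : G.Adj v x) : x = a ∨ x = b ∨ x = c := by
  obtain ⟨d, hd⟩ := exists_third_neighbor hdeg ha hb hab
  have := hd c hc
  have := hd x hx
  grind

theorem exists_third_neighbor_of_cubic (hcub : ∀ v x, G.Adj v x → G.degree v = 3) {v a b : V}
    (ha : G.Adj v a) (hab : a ≠ b) :
    ∃ c, G.Adj v c ∧ c ≠ a ∧ c ≠ b := by
  have h1 : ({a, b} : Finset V).card < (G.neighborFinset v).card := by
    rw [card_neighborFinset_eq_degree, hcub v a ha, Finset.card_pair hab]
    omega
  obtain ⟨c, hc, hc'⟩ := Finset.exists_mem_notMem_of_card_lt_card h1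
  exact ⟨c, by simpa using hc, by simpa using hc'⟩

/-! ### Extending colourings after the deletion of vertices -/

variable (G) in
/-- The edges of `G` that survive the deletion of any set of vertices with at least one edge have
a colouring with seven colours that respects all conflicts of `G` among them. This is what the
induction hypothesis provides. -/
def DeletionColorable : Prop :=
  ∀ W : Finset V, (∃ w ∈ W, ∃ x, G.Adj w x) →
    ∃ c : Sym2 V → Fin 7, ProperOn (conflictGraph G) c {e | ∀ w ∈ W, w ∉ e}

/-- If every edge at a deleted vertex has at most six conflicts, the deleted edges can be coloured
one after the other. -/
theorem DeletionColorable.colorable_of_card_le_six (hdel : DeletionColorable G) (W : Finset V)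
    (hW : ∃ w ∈ W, ∃ x, G.Adj w x)
    (h : ∀ w ∈ W, ∀ x, G.Adj w x → ∃ B : Finset (Sym2 V), B.card ≤ 6 ∧
      ∀ f, (conflictGraph G).Adj s(w, x) f → f ∈ B) : (conflictGraph G).Colorable 7 := by
  obtain ⟨c, hc⟩ := hdel W hW
  have key : ∀ F : Finset (Sym2 V), (∀ e ∈ F, ∃ w ∈ W, ∃ x, G.Adj w x ∧ e = s(w, x)) →
      ∃ c : Sym2 V → Fin 7, ProperOn (conflictGraph G) c ({e | ∀ w ∈ W, w ∉ e} ∪ F) := by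
    intro F
    induction F using Finset.induction_on with
    | empty => intro _; exact ⟨c, by simpa using hc⟩
    | insert e F _ ih =>
      intro hF
      obtain ⟨c', hc'⟩ := ih fun f hf => hF f (Finset.mem_insert_of_mem hf)
      obtain ⟨w, hw, x, hwx, rfl⟩ := hF e (Finset.mem_insert_self _ _)
      obtain ⟨B, hB, hB'⟩ := h w hw x hwx
      obtain ⟨c'', hc'', -⟩ := hc'.exists_insert (v := s(w, x)) (B.image c')
        (Finset.card_image_le.trans_lt (by omega))
        (fun y _ _ hy => Finset.mem_image_of_mem _ (hB' y hy))
      refine ⟨c'', hc''.mono fun f hf => ?_⟩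
      simp only [Finset.coe_insert, Set.mem_union, Set.mem_insert_iff] at hf ⊢
      tauto
  obtain ⟨c', hc'⟩ := key (Finset.univ.filter fun e => ∃ w ∈ W, ∃ x, G.Adj w x ∧ e = s(w, x))
    (fun e he => (Finset.mem_filter.1 he).2)
  refine hc'.colorable fun e f hef => ?_
  obtain ⟨u, v, rfl, huv⟩ := exists_adj_of_conflictGraph_adj hef
  by_cases hu : u ∈ W
  · exact .inr (Finset.mem_filter.2 ⟨Finset.mem_univ _, u, hu, v, huv, rfl⟩)
  by_cases hv : v ∈ W
  · exact .inr (Finset.mem_filter.2 ⟨Finset.mem_univ _, v, hv, u, huv.symm, Sym2.eq_swap⟩)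
  · left
    rintro w hw h
    rcases Sym2.mem_iff.1 h with rfl | rfl <;> contradiction

end Conflict

/-! ### Reducibility of small degrees, diamonds, and vertices with three common neighbours -/

section Reducible

variable {V : Type*} [Fintype V] [DecidableEq V] {G : SimpleGraph V} [DecidableRel G.Adj]

/-- A vertex of degree one or two is reducible. -/
theorem DeletionColorable.of_degree_le_two (hdel : DeletionColorable G)
    (hdeg : ∀ v, G.degree v ≤ 3) {v u : V} (hvu : G.Adj v u) (hv : G.degree v ≤ 2) :
    (conflictGraph G).Colorable 7 := by
  refine hdel.colorable_of_card_le_six {v} ⟨v, by simp, u, hvu⟩ fun w hw x hwx => ?_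
  rw [Finset.mem_singleton] at hw
  subst hw
  refine ⟨_, ?_, fun f hf => mem_conflictsVia_union hf⟩
  have h1 := Finset.card_union_le (conflictsVia G w x) (conflictsVia G x w)
  have h2 := card_conflictsVia_le hdeg hwx
  have h3 := card_conflictsVia_le_four hdeg hwx.symm
  omega

theorem exists_two_edges (hdeg : ∀ v, G.degree v ≤ 3) (w v : V) :
    ∃ S : Finset (Sym2 V), S.card ≤ 2 ∧ (G.Adj w v → ∀ y, G.Adj w y → y ≠ v → s(w, y) ∈ S) := by
  by_cases h : G.Adj w v
  · exact ⟨_, card_edgesAt_le hdeg h, fun _ y h₁ h₂ => mem_edgesAt h₁ h₂⟩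
  · exact ⟨∅, by simp, fun h' => absurd h' h⟩

theorem card_union_le_six {α : Type*} [DecidableEq α] (a b c d : α) {S : Finset α}
    (hS : S.card ≤ 2) : (({a, b, c, d} : Finset α) ∪ S).card ≤ 6 := by
  have := Finset.card_union_le {a, b, c, d} S
  have := Finset.card_le_four (a := a) (b := b) (c := c) (d := d)
  omega

/-- In two triangles `abc`, `abd` with a common edge `ab`, the edge `ac` has at most six
conflicts. -/
theorem card_conflicts_le_six_of_diamond (hdeg : ∀ v, G.degree v ≤ 3) {a b c d : V}
    (hab : G.Adj a b) (hac : G.Adj a c) (had : G.Adj a d) (hbc : G.Adj b c) (hbd : G.Adj b d)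
    (hcd : c ≠ d) : ∃ B : Finset (Sym2 V), B.card ≤ 6 ∧
      ∀ f, (conflictGraph G).Adj s(a, c) f → f ∈ B := by
  obtain ⟨c', hc'⟩ := exists_third_neighbor hdeg hac.symm hbc.symm hab.ne
  obtain ⟨d', hd'⟩ := exists_third_neighbor hdeg had.symm hbd.symm hab.ne
  have ha := eq_of_three_neighbors hdeg hab hac had hbc.ne hbd.ne hcd
  have hb := eq_of_three_neighbors hdeg hab.symm hbc hbd hac.ne had.ne hcd
  obtain ⟨S, hS, hS'⟩ := exists_two_edges hdeg c' c
  refine ⟨{s(b, c), s(b, d), s(d, d'), s(a, b)} ∪ S, card_union_le_six _ _ _ _ hS, ?_⟩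
  intro f hf
  simp only [Finset.mem_union, Finset.mem_insert, Finset.mem_singleton]
  rcases exists_of_conflictGraph_adj hf with ⟨x, y, h₁, h₂, h₃, h₄, rfl⟩ | ⟨x, y, h₁, h₂, h₃, h₄, rfl⟩
  · rcases ha x h₁ with rfl | rfl | rfl
    · rcases hb y h₃ with rfl | rfl | rfl <;> simp_all
    · exact absurd rfl h₂
    · rcases hd' y h₃ with rfl | rfl | rfl <;> simp_all
  · rcases hc' x h₁ with rfl | rfl | rfl
    · exact absurd rfl h₂
    · rcases hb y h₃ with rfl | rfl | rfl <;> simp_all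
    · exact .inr (hS' h₁.symm y h₃ h₄)

/-- Two triangles with a common edge are reducible. -/
theorem DeletionColorable.of_diamond (hdel : DeletionColorable G) (hdeg : ∀ v, G.degree v ≤ 3)
    {a b c d : V} (hab : G.Adj a b) (hac : G.Adj a c) (had : G.Adj a d) (hbc : G.Adj b c)
    (hbd : G.Adj b d) (hcd : c ≠ d) : (conflictGraph G).Colorable 7 := by
  have ha := eq_of_three_neighbors hdeg hab hac had hbc.ne hbd.ne hcd
  have hb := eq_of_three_neighbors hdeg hab.symm hbc hbd hac.ne had.ne hcd
  have hAB : ∃ B : Finset (Sym2 V), B.card ≤ 6 ∧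
      ∀ f, (conflictGraph G).Adj s(a, b) f → f ∈ B := by
    obtain ⟨c', hc'⟩ := exists_third_neighbor hdeg hac.symm hbc.symm hab.ne
    obtain ⟨d', hd'⟩ := exists_third_neighbor hdeg had.symm hbd.symm hab.ne
    refine ⟨{s(b, c), s(b, d), s(a, c), s(a, d)} ∪ {s(c, c'), s(d, d')},
      card_union_le_six _ _ _ _ Finset.card_le_two, ?_⟩
    intro f hf
    simp only [Finset.mem_union, Finset.mem_insert, Finset.mem_singleton]
    rcases exists_of_conflictGraph_adj hf with
      ⟨x, y, h₁, h₂, h₃, h₄, rfl⟩ | ⟨x, y, h₁, h₂, h₃, h₄, rfl⟩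
    · rcases ha x h₁ with rfl | rfl | rfl
      · exact absurd rfl h₂
      · rcases hc' y h₃ with rfl | rfl | rfl <;> simp_all
      · rcases hd' y h₃ with rfl | rfl | rfl <;> simp_all
    · rcases hb x h₁ with rfl | rfl | rfl
      · exact absurd rfl h₂
      · rcases hc' y h₃ with rfl | rfl | rfl <;> simp_all
      · rcases hd' y h₃ with rfl | rfl | rfl <;> simp_all
  refine hdel.colorable_of_card_le_six {a, b} ⟨a, by simp, b, hab⟩ fun w hw x hwx => ?_
  simp only [Finset.mem_insert, Finset.mem_singleton] at hw
  rcases hw with rfl | rfl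
  · rcases ha x hwx with rfl | rfl | rfl
    · exact hAB
    · exact card_conflicts_le_six_of_diamond hdeg hab hac had hbc hbd hcd
    · exact card_conflicts_le_six_of_diamond hdeg hab had hac hbd hbc hcd.symm
  · rcases hb x hwx with rfl | rfl | rfl
    · rwa [Sym2.eq_swap]
    · exact card_conflicts_le_six_of_diamond hdeg hab.symm hbc hbd hac had hcd
    · exact card_conflicts_le_six_of_diamond hdeg hab.symm hbd hbc had hac hcd.symm

/-- If the vertices `u`, `v` have the three common neighbours `x`, `y`, `z`, the edge `ux` has at
most six conflicts. -/
theorem card_conflicts_le_six_of_bipartite (hdeg : ∀ v, G.degree v ≤ 3) {u v x y z : V}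
    (huv : u ≠ v) (hux : G.Adj u x) (huy : G.Adj u y) (huz : G.Adj u z) (hvx : G.Adj v x)
    (hvy : G.Adj v y) (hvz : G.Adj v z) (hxy : x ≠ y) (hxz : x ≠ z) (hyz : y ≠ z) :
    ∃ B : Finset (Sym2 V), B.card ≤ 6 ∧ ∀ f, (conflictGraph G).Adj s(u, x) f → f ∈ B := by
  have hu := eq_of_three_neighbors hdeg hux huy huz hxy hxz hyz
  have hv := eq_of_three_neighbors hdeg hvx hvy hvz hxy hxz hyz
  obtain ⟨x', hx'⟩ := exists_third_neighbor hdeg hux.symm hvx.symm huv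
  obtain ⟨y', hy'⟩ := exists_third_neighbor hdeg huy.symm hvy.symm huv
  obtain ⟨z', hz'⟩ := exists_third_neighbor hdeg huz.symm hvz.symm huv
  obtain ⟨S, hS, hS'⟩ := exists_two_edges hdeg x' x
  refine ⟨{s(y, v), s(y, y'), s(z, v), s(z, z')} ∪ S, card_union_le_six _ _ _ _ hS, ?_⟩
  intro f hf
  simp only [Finset.mem_union, Finset.mem_insert, Finset.mem_singleton]
  rcases exists_of_conflictGraph_adj hf with ⟨p, q, h₁, h₂, h₃, h₄, rfl⟩ | ⟨p, q, h₁, h₂, h₃, h₄, rfl⟩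
  · rcases hu p h₁ with rfl | rfl | rfl
    · exact absurd rfl h₂
    · rcases hy' q h₃ with rfl | rfl | rfl <;> simp_all
    · rcases hz' q h₃ with rfl | rfl | rfl <;> simp_all
  · rcases hx' p h₁ with rfl | rfl | rfl
    · exact absurd rfl h₂
    · rcases hv q h₃ with rfl | rfl | rfl <;> simp_all
    · exact .inr (hS' h₁.symm q h₃ h₄)

/-- Two vertices with three common neighbours are reducible. -/
theorem DeletionColorable.of_bipartite (hdel : DeletionColorable G) (hdeg : ∀ v, G.degree v ≤ 3)
    {u v x y z : V} (huv : u ≠ v) (hux : G.Adj u x) (huy : G.Adj u y) (huz : G.Adj u z)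
    (hvx : G.Adj v x) (hvy : G.Adj v y) (hvz : G.Adj v z) (hxy : x ≠ y) (hxz : x ≠ z)
    (hyz : y ≠ z) : (conflictGraph G).Colorable 7 := by
  have key : ∀ {u v : V}, u ≠ v → G.Adj u x → G.Adj u y → G.Adj u z → G.Adj v x → G.Adj v y →
      G.Adj v z → ∀ w, G.Adj u w → ∃ B : Finset (Sym2 V), B.card ≤ 6 ∧
        ∀ f, (conflictGraph G).Adj s(u, w) f → f ∈ B := by
    intro u v huv hux huy huz hvx hvy hvz w huw
    rcases eq_of_three_neighbors hdeg hux huy huz hxy hxz hyz w huw with rfl | rfl | rfl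
    · exact card_conflicts_le_six_of_bipartite hdeg huv hux huy huz hvx hvy hvz hxy hxz hyz
    · exact card_conflicts_le_six_of_bipartite hdeg huv huy hux huz hvy hvx hvz hxy.symm hyz hxz
    · exact card_conflicts_le_six_of_bipartite hdeg huv huz hux huy hvz hvx hvy hxz.symm hyz.symm
        hxy
  refine hdel.colorable_of_card_le_six {u, v} ⟨u, by simp, x, hux⟩ fun w hw t hwt => ?_
  simp only [Finset.mem_insert, Finset.mem_singleton] at hw
  rcases hw with rfl | rfl
  · exact key huv hux huy huz hvx hvy hvz t hwt
  · exact key huv.symm hvx hvy hvz hux huy huz t hwt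

theorem exists_override {α β : Type*} (k : α → β) (l : List (α × β))
    (hl : (l.map Prod.fst).Nodup) :
    ∃ k' : α → β, (∀ p ∈ l, k' p.1 = p.2) ∧ ∀ e ∉ l.map Prod.fst, k' e = k e := by
  classical
  induction l with
  | nil => exact ⟨k, by simp, fun _ _ => rfl⟩
  | cons p l ih =>
    rw [List.map_cons, List.nodup_cons] at hl
    obtain ⟨k', h₁, h₂⟩ := ih hl.2
    refine ⟨Function.update k' p.1 p.2, fun q hq => ?_, fun e he => ?_⟩
    · rcases List.mem_cons.1 hq with rfl | hq
      · simp
      · rw [Function.update_of_ne, h₁ q hq]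
        exact fun e => hl.1 (e ▸ List.mem_map_of_mem hq)
    · rw [List.map_cons, List.mem_cons, not_or] at he
      rw [Function.update_of_ne he.1, h₂ e he.2]

theorem le_card_univ_sdiff {n k : ℕ} {B : Finset (Fin n)} (h : B.card + k ≤ n) :
    k ≤ (Finset.univ \ B).card := by
  rw [Finset.card_sdiff_of_subset (Finset.subset_univ _), Finset.card_univ, Fintype.card_fin]
  omega

/-- The colours not seen at `w` past the edge `wv`. -/
theorem exists_palette_at (hdeg : ∀ v, G.degree v ≤ 3) (c : Sym2 V → Fin 7) {w v : V}
    (h : G.Adj w v) : ∃ A : Finset (Fin 7), 5 ≤ A.card ∧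
      ∀ k ∈ A, ∀ y, G.Adj w y → y ≠ v → k ≠ c s(w, y) := by
  have := card_edgesAt_le hdeg h
  refine ⟨Finset.univ \ (edgesAt G w v).image c, le_card_univ_sdiff ?_, ?_⟩
  · have := Finset.card_image_le (s := edgesAt G w v) (f := c)
    omega
  · rintro k hk y hy hyv rfl
    exact (Finset.mem_sdiff.1 hk).2 (Finset.mem_image_of_mem _ (mem_edgesAt hy hyv))

theorem three_le_card_inter {A B : Finset (Fin 7)} (hA : 5 ≤ A.card) (hB : 5 ≤ B.card) :
    3 ≤ (A ∩ B).card := by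
  have h1 := Finset.card_union_add_card_inter A B
  have h2 := Finset.card_le_univ (A ∪ B)
  rw [Fintype.card_fin] at h2
  omega

/-- The colours not seen at `w` by the edge `wv`, when a set `E` of uncoloured edges is
disregarded. -/
theorem exists_palette_via (hdeg : ∀ v, G.degree v ≤ 3) (c : Sym2 V → Fin 7) {w v : V}
    (h : G.Adj w v) (E : Finset (Sym2 V)) : ∃ L : Finset (Fin 7),
      3 + (conflictsVia G w v ∩ E).card ≤ L.card ∧
      ∀ k ∈ L, ∀ x y, G.Adj w x → x ≠ v → G.Adj x y → y ≠ w → s(x, y) ∉ E → k ≠ c s(x, y) := by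
  have h4 := card_conflictsVia_le_four hdeg h
  refine ⟨Finset.univ \ (conflictsVia G w v \ E).image c, le_card_univ_sdiff ?_, ?_⟩
  · have h1 := Finset.card_image_le (s := conflictsVia G w v \ E) (f := c)
    have h2 := Finset.card_sdiff_add_card_inter (conflictsVia G w v) E
    omega
  · rintro k hk x y hx hxv hxy hyw hE rfl
    exact (Finset.mem_sdiff.1 hk).2 (Finset.mem_image_of_mem _
      (Finset.mem_sdiff.2 ⟨mem_conflictsVia hx hxv hxy hyw, hE⟩))

end Reducible

/-! ### Reducibility of triangles -/

section Reducible

variable {V : Type*} [Fintype V] [DecidableEq V] {G : SimpleGraph V} [DecidableRel G.Adj]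

/-- Prescribing the colours of the edges of a triangle and of the edges leaving it. -/
theorem exists_override_triangle {V : Type*} {a b c a' b' c' : V} (hab : a ≠ b) (hac : a ≠ c)
    (hbc : b ≠ c) (hab' : a' ≠ b) (hac' : a' ≠ c) (hba' : b' ≠ a) (hbc' : b' ≠ c) (hca' : c' ≠ a)
    (hcb' : c' ≠ b) {β : Type*} (k : Sym2 V → β) (x₁ x₂ x₃ y₁ y₂ y₃ : β) :
    ∃ k' : Sym2 V → β, k' s(b, c) = x₁ ∧ k' s(a, c) = x₂ ∧ k' s(a, b) = x₃ ∧ k' s(a, a') = y₁ ∧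
      k' s(b, b') = y₂ ∧ k' s(c, c') = y₃ ∧ ∀ e, a ∉ e → b ∉ e → c ∉ e → k' e = k e := by
  obtain ⟨k', h₁, h₂⟩ := exists_override k [(s(b, c), x₁), (s(a, c), x₂), (s(a, b), x₃),
    (s(a, a'), y₁), (s(b, b'), y₂), (s(c, c'), y₃)]
    (by
      simp only [List.map_cons, List.map_nil, List.nodup_cons, List.mem_cons, Sym2.eq_iff,
        List.not_mem_nil, List.nodup_nil, or_false, not_false_eq_true, and_true]
      grind)
  simp only [List.mem_cons, List.not_mem_nil, or_false, forall_eq_or_imp, forall_eq] at h₁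
  refine ⟨k', h₁.1, h₁.2.1, h₁.2.2.1, h₁.2.2.2.1, h₁.2.2.2.2.1, h₁.2.2.2.2.2, ?_⟩
  intro e ha hb hc
  refine h₂ e ?_
  simp only [List.map_cons, List.map_nil, List.mem_cons, List.not_mem_nil, or_false]
  rintro (rfl | rfl | rfl | rfl | rfl | rfl) <;> simp at ha hb hc

/-- A triangle is reducible: the conflict graph of the edges of the triangle and the edges leaving
it is a prism, and every list has three colours. -/
theorem DeletionColorable.of_triangle (hdel : DeletionColorable G)
    (hdeg : ∀ v, G.degree v ≤ 3) (hcub : ∀ v x, G.Adj v x → G.degree v = 3) {a b c : V}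
    (hab : G.Adj a b) (hac : G.Adj a c) (hbc : G.Adj b c) : (conflictGraph G).Colorable 7 := by
  by_cases hdia : ∃ x y z w, G.Adj x y ∧ G.Adj x z ∧ G.Adj x w ∧ G.Adj y z ∧ G.Adj y w ∧ z ≠ w
  · obtain ⟨x, y, z, w, h₁, h₂, h₃, h₄, h₅, h₆⟩ := hdia
    exact hdel.of_diamond hdeg h₁ h₂ h₃ h₄ h₅ h₆
  push Not at hdia
  obtain ⟨a', ha', hab', hac'⟩ := exists_third_neighbor_of_cubic hcub hab hbc.ne
  obtain ⟨b', hb', hba', hbc'⟩ := exists_third_neighbor_of_cubic hcub hab.symm hac.ne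
  obtain ⟨c', hc', hca', hcb'⟩ := exists_third_neighbor_of_cubic hcub hac.symm hab.ne
  have na := eq_of_three_neighbors hdeg hab hac ha' hbc.ne hab'.symm hac'.symm
  have nb := eq_of_three_neighbors hdeg hab.symm hbc hb' hac.ne hba'.symm hbc'.symm
  have nc := eq_of_three_neighbors hdeg hac.symm hbc.symm hc' hab.ne hca'.symm hcb'.symm
  -- The outer ends of the three edges leaving the triangle are distinct, as there is no diamond.
  have e₁ : a' ≠ b' := by rintro rfl; exact hac' (hdia a b c a' hab hac ha' hbc hb').symm
  have e₂ : a' ≠ c' := by rintro rfl; exact hab' (hdia a c b a' hac hab ha' hbc.symm hc').symm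
  have e₃ : b' ≠ c' := by
    rintro rfl; exact hba' (hdia b c a b' hbc hab.symm hb' hac.symm hc').symm
  obtain ⟨k, hk⟩ := hdel {a, b, c} ⟨a, by simp, b, hab⟩
  obtain ⟨A, cA, hA⟩ := exists_palette_at hdeg k ha'.symm
  obtain ⟨B, cB, hB⟩ := exists_palette_at hdeg k hb'.symm
  obtain ⟨C, cC, hC⟩ := exists_palette_at hdeg k hc'.symm
  obtain ⟨LA, dA, hLA⟩ := exists_palette_via hdeg k ha'.symm ∅
  obtain ⟨LB, dB, hLB⟩ := exists_palette_via hdeg k hb'.symm ∅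
  obtain ⟨LC, dC, hLC⟩ := exists_palette_via hdeg k hc'.symm ∅
  obtain ⟨x₁, m₁, x₂, m₂, x₃, m₃, y₁, n₁, y₂, n₂, y₃, n₃, ⟨f₁, f₂, f₃⟩, ⟨g₁, g₂, g₃⟩, i₁, i₂, i₃⟩ :=
    exists_coloring_prism (three_le_card_inter cB cC) (three_le_card_inter cA cC)
      (three_le_card_inter cA cB) (show 3 ≤ LA.card by omega) (show 3 ≤ LB.card by omega)
      (show 3 ≤ LC.card by omega)
  rw [Finset.mem_inter] at m₁ m₂ m₃
  have hA₂ := hA x₂ m₂.1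
  have hA₃ := hA x₃ m₃.1
  have hB₁ := hB x₁ m₁.1
  have hB₃ := hB x₃ m₃.2
  have hC₁ := hC x₁ m₁.2
  have hC₂ := hC x₂ m₂.2
  have hLA := hLA y₁ n₁
  have hLB := hLB y₂ n₂
  have hLC := hLC y₃ n₃
  simp only [Finset.notMem_empty, not_false_eq_true, forall_const] at hLA hLB hLC
  clear hA hB hC hdia
  have nab := hab.ne
  have nac := hac.ne
  have nbc := hbc.ne
  have naa := ha'.ne
  have nbb := hb'.ne
  have ncc := hc'.ne
  obtain ⟨k', q₁, q₂, q₃, p₁, p₂, p₃, hout⟩ := exists_override_triangle hab.ne hac.ne hbc.ne hab'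
    hac' hba' hbc' hca' hcb' k x₁ x₂ x₃ y₁ y₂ y₃
  have out : ∀ x y, x ≠ a → x ≠ b → x ≠ c → y ≠ a → y ≠ b → y ≠ c → k' s(x, y) = k s(x, y) :=
    fun x y h₁ h₂ h₃ h₄ h₅ h₆ => hout _ (by simp [h₁.symm, h₄.symm])
      (by simp [h₂.symm, h₅.symm]) (by simp [h₃.symm, h₆.symm])
  have q₁' : k' s(c, b) = x₁ := by rw [Sym2.eq_swap, q₁]
  have q₂' : k' s(c, a) = x₂ := by rw [Sym2.eq_swap, q₂]
  have q₃' : k' s(b, a) = x₃ := by rw [Sym2.eq_swap, q₃]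
  have p₁' : k' s(a', a) = y₁ := by rw [Sym2.eq_swap, p₁]
  have p₂' : k' s(b', b) = y₂ := by rw [Sym2.eq_swap, p₂]
  have p₃' : k' s(c', c) = y₃ := by rw [Sym2.eq_swap, p₃]
  -- No outer end has a second neighbour on the triangle.
  have sa : ∀ x, G.Adj x a → x ≠ b → x ≠ c → x = a' := fun x h => by have := na x h.symm; tauto
  have sb : ∀ x, G.Adj x b → x ≠ a → x ≠ c → x = b' := fun x h => by have := nb x h.symm; tauto
  have sc : ∀ x, G.Adj x c → x ≠ a → x ≠ b → x = c' := fun x h => by have := nc x h.symm; tauto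
  have oa : ∀ y, G.Adj a' y → y ≠ a → k' s(a', y) = k s(a', y) := fun y h hy =>
    out _ _ naa.symm hab' hac' hy (fun e => e₁ (sb _ (e ▸ h) naa.symm hac'))
      (fun e => e₂ (sc _ (e ▸ h) naa.symm hab'))
  have ob : ∀ y, G.Adj b' y → y ≠ b → k' s(b', y) = k s(b', y) := fun y h hy =>
    out _ _ hba' nbb.symm hbc' (fun e => e₁ (sa _ (e ▸ h) nbb.symm hbc').symm) hy
      (fun e => e₃ (sc _ (e ▸ h) hba' nbb.symm))
  have oc : ∀ y, G.Adj c' y → y ≠ c → k' s(c', y) = k s(c', y) := fun y h hy =>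
    out _ _ hca' hcb' ncc.symm (fun e => e₂ (sa _ (e ▸ h) hcb' ncc.symm).symm)
      (fun e => e₃ (sb _ (e ▸ h) hca' ncc.symm).symm) hy
  have E₃ : ∀ f, (conflictGraph G).Adj s(a, b) f → x₃ ≠ k' f := by
    intro f hf
    rcases exists_of_conflictGraph_adj hf with
      ⟨x, y, h₁, h₂, h₃, h₄, rfl⟩ | ⟨x, y, h₁, h₂, h₃, h₄, rfl⟩
    · rcases na x h₁ with rfl | rfl | rfl
      · exact absurd rfl h₂
      · rcases nc y h₃ with rfl | rfl | rfl
        · exact absurd rfl h₄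
        · rw [q₁']; exact f₃.symm
        · rw [p₃]; exact i₃
      · rw [oa y h₃ h₄]; exact hA₃ y h₃ h₄
    · rcases nb x h₁ with rfl | rfl | rfl
      · exact absurd rfl h₂
      · rcases nc y h₃ with rfl | rfl | rfl
        · rw [q₂']; exact f₂.symm
        · exact absurd rfl h₄
        · rw [p₃]; exact i₃
      · rw [ob y h₃ h₄]; exact hB₃ y h₃ h₄
  have E₂ : ∀ f, (conflictGraph G).Adj s(a, c) f → x₂ ≠ k' f := by
    intro f hf
    rcases exists_of_conflictGraph_adj hf with
      ⟨x, y, h₁, h₂, h₃, h₄, rfl⟩ | ⟨x, y, h₁, h₂, h₃, h₄, rfl⟩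
    · rcases na x h₁ with rfl | rfl | rfl
      · rcases nb y h₃ with rfl | rfl | rfl
        · exact absurd rfl h₄
        · rw [q₁]; exact f₁.symm
        · rw [p₂]; exact i₂
      · exact absurd rfl h₂
      · rw [oa y h₃ h₄]; exact hA₂ y h₃ h₄
    · rcases nc x h₁ with rfl | rfl | rfl
      · exact absurd rfl h₂
      · rcases nb y h₃ with rfl | rfl | rfl
        · rw [q₃']; exact f₂
        · exact absurd rfl h₄
        · rw [p₂]; exact i₂
      · rw [oc y h₃ h₄]; exact hC₂ y h₃ h₄
  have E₁ : ∀ f, (conflictGraph G).Adj s(b, c) f → x₁ ≠ k' f := by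
    intro f hf
    rcases exists_of_conflictGraph_adj hf with
      ⟨x, y, h₁, h₂, h₃, h₄, rfl⟩ | ⟨x, y, h₁, h₂, h₃, h₄, rfl⟩
    · rcases nb x h₁ with rfl | rfl | rfl
      · rcases na y h₃ with rfl | rfl | rfl
        · exact absurd rfl h₄
        · rw [q₂]; exact f₁
        · rw [p₁]; exact i₁
      · exact absurd rfl h₂
      · rw [ob y h₃ h₄]; exact hB₁ y h₃ h₄
    · rcases nc x h₁ with rfl | rfl | rfl
      · rcases na y h₃ with rfl | rfl | rfl
        · rw [q₃]; exact f₃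
        · exact absurd rfl h₄
        · rw [p₁]; exact i₁
      · exact absurd rfl h₂
      · rw [oc y h₃ h₄]; exact hC₁ y h₃ h₄
  have P₁ : ∀ f, (conflictGraph G).Adj s(a, a') f → y₁ ≠ k' f := by
    intro f hf
    rcases exists_of_conflictGraph_adj hf with
      ⟨x, y, h₁, h₂, h₃, h₄, rfl⟩ | ⟨x, y, h₁, h₂, h₃, h₄, rfl⟩
    · rcases na x h₁ with rfl | rfl | rfl
      · rcases nb y h₃ with rfl | rfl | rfl
        · exact absurd rfl h₄
        · rw [q₁]; exact i₁.symm
        · rw [p₂]; exact g₁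
      · rcases nc y h₃ with rfl | rfl | rfl
        · exact absurd rfl h₄
        · rw [q₁']; exact i₁.symm
        · rw [p₃]; exact g₃
      · exact absurd rfl h₂
    · have hxb : x ≠ b := fun e => e₁ (sb _ (e ▸ h₁) naa.symm hac')
      have hxc : x ≠ c := fun e => e₂ (sc _ (e ▸ h₁) naa.symm hab')
      by_cases hyb : y = b
      · subst hyb; rw [sb x h₃ h₂ hxc, p₂']; exact g₁
      by_cases hyc : y = c
      · subst hyc; rw [sc x h₃ h₂ hxb, p₃']; exact g₃
      have hya : y ≠ a := fun e => h₁.ne' (sa x (e ▸ h₃) hxb hxc)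
      rw [out x y h₂ hxb hxc hya hyb hyc]
      exact hLA x y h₁ h₂ h₃ h₄
  have P₂ : ∀ f, (conflictGraph G).Adj s(b, b') f → y₂ ≠ k' f := by
    intro f hf
    rcases exists_of_conflictGraph_adj hf with
      ⟨x, y, h₁, h₂, h₃, h₄, rfl⟩ | ⟨x, y, h₁, h₂, h₃, h₄, rfl⟩
    · rcases nb x h₁ with rfl | rfl | rfl
      · rcases na y h₃ with rfl | rfl | rfl
        · exact absurd rfl h₄
        · rw [q₂]; exact i₂.symm
        · rw [p₁]; exact g₁.symm
      · rcases nc y h₃ with rfl | rfl | rfl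
        · rw [q₂']; exact i₂.symm
        · exact absurd rfl h₄
        · rw [p₃]; exact g₂
      · exact absurd rfl h₂
    · have hxa : x ≠ a := fun e => e₁ (sa _ (e ▸ h₁) nbb.symm hbc').symm
      have hxc : x ≠ c := fun e => e₃ (sc _ (e ▸ h₁) hba' nbb.symm)
      by_cases hya : y = a
      · subst hya; rw [sa x h₃ h₂ hxc, p₁']; exact g₁.symm
      by_cases hyc : y = c
      · subst hyc; rw [sc x h₃ hxa h₂, p₃']; exact g₂
      have hyb : y ≠ b := fun e => h₁.ne' (sb x (e ▸ h₃) hxa hxc)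
      rw [out x y hxa h₂ hxc hya hyb hyc]
      exact hLB x y h₁ h₂ h₃ h₄
  have P₃ : ∀ f, (conflictGraph G).Adj s(c, c') f → y₃ ≠ k' f := by
    intro f hf
    rcases exists_of_conflictGraph_adj hf with
      ⟨x, y, h₁, h₂, h₃, h₄, rfl⟩ | ⟨x, y, h₁, h₂, h₃, h₄, rfl⟩
    · rcases nc x h₁ with rfl | rfl | rfl
      · rcases na y h₃ with rfl | rfl | rfl
        · rw [q₃]; exact i₃.symm
        · exact absurd rfl h₄
        · rw [p₁]; exact g₃.symm
      · rcases nb y h₃ with rfl | rfl | rfl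
        · rw [q₃']; exact i₃.symm
        · exact absurd rfl h₄
        · rw [p₂]; exact g₂.symm
      · exact absurd rfl h₂
    · have hxa : x ≠ a := fun e => e₂ (sa _ (e ▸ h₁) hcb' ncc.symm).symm
      have hxb : x ≠ b := fun e => e₃ (sb _ (e ▸ h₁) hca' ncc.symm).symm
      by_cases hya : y = a
      · subst hya; rw [sa x h₃ hxb h₂, p₁']; exact g₃.symm
      by_cases hyb : y = b
      · subst hyb; rw [sb x h₃ hxa h₂, p₂']; exact g₂.symm
      have hyc : y ≠ c := fun e => h₁.ne' (sc x (e ▸ h₃) hxa hxb)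
      rw [out x y hxa hxb h₂ hya hyb hyc]
      exact hLC x y h₁ h₂ h₃ h₄
  refine colorable_of_extension hk k' (fun e he => hout e (he a (by simp)) (he b (by simp))
    (he c (by simp))) fun w hw x hwx f hf => ?_
  simp only [Finset.mem_insert, Finset.mem_singleton] at hw
  rcases hw with rfl | rfl | rfl
  · rcases na x hwx with rfl | rfl | rfl
    · rw [q₃]; exact E₃ f hf
    · rw [q₂]; exact E₂ f hf
    · rw [p₁]; exact P₁ f hf
  · rcases nb x hwx with rfl | rfl | rfl
    · rw [q₃']; exact E₃ f (by rwa [Sym2.eq_swap] at hf)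
    · rw [q₁]; exact E₁ f hf
    · rw [p₂]; exact P₂ f hf
  · rcases nc x hwx with rfl | rfl | rfl
    · rw [q₂']; exact E₂ f (by rwa [Sym2.eq_swap] at hf)
    · rw [q₁']; exact E₁ f (by rwa [Sym2.eq_swap] at hf)
    · rw [p₃]; exact P₃ f hf

end Reducible

/-! ### Reducibility of cycles of length four -/

section Reducible

variable {V : Type*} [Fintype V] [DecidableEq V] {G : SimpleGraph V} [DecidableRel G.Adj]

theorem forall_fin_four {P : Fin 4 → Prop} : (∀ i, P i) ↔ P 0 ∧ P 1 ∧ P 2 ∧ P 3 := by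
  rw [Fin.forall_fin_succ, Fin.forall_fin_succ, Fin.forall_fin_succ, Fin.forall_fin_one]
  rfl

/-- The edges of a cycle `v 0, v 1, v 2, v 3` and of a matching that leaves it are distinct. -/
theorem injective_square_edges {V : Type*} {v w : Fin 4 → V} (hv : Function.Injective v)
    (hvw : ∀ i j, w i ≠ v j) : Function.Injective
      (Sum.elim (fun i => s(v i, v (i + 1))) fun i => s(v i, w i) : Fin 4 ⊕ Fin 4 → Sym2 V) := by
  have h2 : ∀ i j : Fin 4, i = j + 1 → i + 1 = j → i = j := by decide
  rintro (i | i) (j | j) h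
  · rcases Sym2.eq_iff.1 h with ⟨h, -⟩ | ⟨h, h'⟩
    · rw [hv h]
    · rw [h2 i j (hv h) (hv h')]
  · rcases Sym2.eq_iff.1 h with ⟨-, h⟩ | ⟨h, -⟩ <;> exact absurd h.symm (hvw _ _)
  · rcases Sym2.eq_iff.1 h with ⟨-, h⟩ | ⟨-, h⟩ <;> exact absurd h (hvw _ _)
  · rcases Sym2.eq_iff.1 h with ⟨h, -⟩ | ⟨-, h⟩
    · rw [hv h]
    · exact absurd h (hvw _ _)

/-- A 4-cycle is reducible if the edges leaving it have distinct outer ends. The conflict graph of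
the deleted edges is that of `exists_coloring_square`. -/
theorem DeletionColorable.of_square_of_injective (hdel : DeletionColorable G)
    (hdeg : ∀ v, G.degree v ≤ 3) {v w : Fin 4 → V} (hv : Function.Injective v)
    (hvw : ∀ i j, w i ≠ v j) (hw : Function.Injective w) (hc : ∀ i, G.Adj (v i) (v (i + 1)))
    (hp : ∀ i, G.Adj (v i) (w i)) : (conflictGraph G).Colorable 7 := by
  have i11 : ∀ i : Fin 4, i + 1 + 1 = i + 2 := by decide
  have i13 : ∀ i : Fin 4, i + 1 + 3 = i := by decide
  have i31 : ∀ i : Fin 4, i + 3 + 1 = i := by decide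
  have i33 : ∀ i : Fin 4, i + 3 + 3 = i + 2 := by decide
  have i21 : ∀ i : Fin 4, i + 2 + 1 = i + 3 := by decide
  have i22 : ∀ i : Fin 4, i + 2 + 2 = i := by decide
  have icases : ∀ i j : Fin 4, j = i ∨ j = i + 1 ∨ j = i + 2 ∨ j = i + 3 := by decide
  have hc' : ∀ i, G.Adj (v i) (v (i + 3)) := fun i => by
    have := hc (i + 3)
    rw [i31] at this
    exact this.symm
  have nb : ∀ i x, G.Adj (v i) x → x = v (i + 1) ∨ x = v (i + 3) ∨ x = w i := fun i =>
    eq_of_three_neighbors hdeg (hc i) (hc' i) (hp i)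
      (hv.ne (by revert i; decide)) (hvw _ _).symm (hvw _ _).symm
  obtain ⟨k, hk⟩ := hdel (Finset.univ.image v) ⟨v 0, by simp, v 1, hc 0⟩
  choose A cA hA using fun i => exists_palette_at hdeg k (hp i).symm
  choose L cL hL using fun i =>
    exists_palette_via hdeg k (hp i).symm (Finset.univ.image fun j => s(v j, w j))
  -- If `w i` and `w (i + 2)` are adjacent, one of the conflicts of the edge at `w i` is uncoloured.
  have hfour : ∀ i, G.Adj (w i) (w (i + 2)) → 4 ≤ (L i).card := by
    intro i h
    have : 0 < (conflictsVia G (w i) (v i) ∩ Finset.univ.image fun j => s(v j, w j)).card := by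
      refine Finset.card_pos.2 ⟨s(w (i + 2), v (i + 2)), Finset.mem_inter.2 ⟨?_, ?_⟩⟩
      · exact mem_conflictsVia h (hvw _ _) (hp _).symm (hvw _ _).symm
      · exact Finset.mem_image.2 ⟨i + 2, by simp, Sym2.eq_swap⟩
    have := cL i
    omega
  have hthree : ∀ i, 3 ≤ (L i).card := fun i => (Nat.le_add_right _ _).trans (cL i)
  obtain ⟨p, q, pL, qA, pq, pp, pp', qq⟩ : ∃ p q : Fin 4 → Fin 7, (∀ i, p i ∈ L i) ∧
      (∀ i, q i ∈ A i ∩ A (i + 1)) ∧ (∀ i, p i ≠ q (i + 1) ∧ p i ≠ q (i + 2)) ∧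
      (∀ i, p i ≠ p (i + 1)) ∧ (∀ i, G.Adj (w i) (w (i + 2)) → p i ≠ p (i + 2)) ∧
      ∀ i, q i ≠ q (i + 2) := by
    have hM : ∀ i, 3 ≤ (A i ∩ A (i + 1)).card := fun i => three_le_card_inter (cA _) (cA _)
    obtain ⟨p₀, m₀, p₁, m₁, p₂, m₂, p₃, m₃, q₀, n₀, q₁, n₁, q₂, n₂, q₃, n₃, h₁, h₂,
      ⟨h₃, h₄, h₅, h₆⟩, ⟨h₇, h₈⟩, ⟨g₁, g₂⟩, ⟨g₃, g₄⟩, ⟨g₅, g₆⟩, g₇, g₈⟩ :=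
      exists_coloring_square (P := G.Adj (w 0) (w 2)) (Q := G.Adj (w 1) (w 3))
        (hthree 0) (hthree 1) (hthree 2) (hthree 3) (hM 0) (hM 1) (hM 2) (hM 3)
        (fun h => ⟨hfour 0 h, hfour 2 h.symm⟩) (fun h => ⟨hfour 1 h, hfour 3 h.symm⟩)
    refine ⟨![p₀, p₁, p₂, p₃], ![q₀, q₁, q₂, q₃], ?_, ?_, ?_, ?_, ?_, ?_⟩ <;>
      rw [forall_fin_four]
    · exact ⟨m₀, m₁, m₂, m₃⟩
    · exact ⟨n₀, n₁, n₂, n₃⟩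
    · exact ⟨⟨g₁, g₂⟩, ⟨g₃, g₄⟩, ⟨g₅, g₆⟩, g₇, g₈⟩
    · exact ⟨h₃, h₄, h₅, h₆⟩
    · exact ⟨h₁, h₂, fun h => (h₁ h.symm).symm, fun h => (h₂ h.symm).symm⟩
    · exact ⟨h₇, h₈, h₇.symm, h₈.symm⟩
  clear cA cL hfour hthree
  have hinj := injective_square_edges hv hvw
  let k' := Function.extend (Sum.elim (fun i => s(v i, v (i + 1))) fun i => s(v i, w i))
    (Sum.elim q p) k
  have kq : ∀ i, k' s(v i, v (i + 1)) = q i := fun i => hinj.extend_apply _ _ (.inl i)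
  have kp : ∀ i, k' s(v i, w i) = p i := fun i => hinj.extend_apply _ _ (.inr i)
  have kq' : ∀ i, k' s(v i, v (i + 3)) = q (i + 3) := fun i => by
    rw [Sym2.eq_swap, ← kq (i + 3), i31]
  have kp' : ∀ i, k' s(w i, v i) = p i := fun i => by rw [Sym2.eq_swap, kp]
  have hout : ∀ e, (∀ i, v i ∉ e) → k' e = k e := by
    intro e he
    refine Function.extend_apply' _ _ _ ?_
    rintro ⟨i | i, rfl⟩ <;> exact he i (by simp)
  have out : ∀ x y, (∀ i, x ≠ v i) → (∀ i, y ≠ v i) → k' s(x, y) = k s(x, y) :=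
    fun x y hx hy => hout _ fun i hi => (Sym2.mem_iff.1 hi).elim (fun e => hx i e.symm)
      fun e => hy i e.symm
  clear_value k'
  -- The only vertex of the cycle adjacent to `w i` is `v i`.
  have hwv : ∀ i j, G.Adj (w i) (v j) → j = i := by
    intro i j h
    rcases nb j _ h.symm with h | h | h
    · exact absurd h (hvw _ _)
    · exact absurd h (hvw _ _)
    · exact (hw h).symm
  have outw : ∀ i y, G.Adj (w i) y → y ≠ v i → k' s(w i, y) = k s(w i, y) := by
    intro i y h hy
    refine out _ _ (hvw i) fun j e => ?_
    subst e
    exact hy (by rw [hwv i j h])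
  have C : ∀ i f, (conflictGraph G).Adj s(v i, v (i + 1)) f → q i ≠ k' f := by
    intro i f hf
    rcases exists_of_conflictGraph_adj hf with
      ⟨x, y, h₁, h₂, h₃, h₄, rfl⟩ | ⟨x, y, h₁, h₂, h₃, h₄, rfl⟩
    · rcases nb _ x h₁ with rfl | rfl | rfl
      · exact absurd rfl h₂
      · rcases nb _ y h₃ with rfl | rfl | rfl
        · exact absurd (by rw [i31]) h₄
        · rw [kq', i33]; exact qq i
        · have := (pq (i + 3)).1
          rw [i31] at this
          rw [kp]; exact this.symm
      · rw [outw i y h₃ h₄]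
        exact hA i _ (Finset.mem_inter.1 (qA i)).1 y h₃ h₄
    · rcases nb _ x h₁ with rfl | rfl | rfl
      · rcases nb _ y h₃ with rfl | rfl | rfl
        · rw [kq, i11]; exact qq i
        · exact absurd (by rw [i13]) h₄
        · have := (pq (i + 2)).2
          rw [i22] at this
          rw [kp, i11]; exact this.symm
      · exact absurd (by rw [i13]) h₂
      · rw [outw _ y h₃ h₄]
        exact hA _ _ (Finset.mem_inter.1 (qA i)).2 y h₃ h₄
  have P : ∀ i f, (conflictGraph G).Adj s(v i, w i) f → p i ≠ k' f := by
    intro i f hf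
    rcases exists_of_conflictGraph_adj hf with
      ⟨x, y, h₁, h₂, h₃, h₄, rfl⟩ | ⟨x, y, h₁, h₂, h₃, h₄, rfl⟩
    · rcases nb _ x h₁ with rfl | rfl | rfl
      · rcases nb _ y h₃ with rfl | rfl | rfl
        · rw [kq]; exact (pq i).1
        · exact absurd (by rw [i13]) h₄
        · rw [kp]; exact pp i
      · rcases nb _ y h₃ with rfl | rfl | rfl
        · exact absurd (by rw [i31]) h₄
        · rw [kq', i33]; exact (pq i).2
        · have := pp (i + 3)
          rw [i31] at this
          rw [kp]; exact this.symm
      · exact absurd rfl h₂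
    · have hx : ∀ j, x ≠ v j := by
        rintro j rfl
        exact h₂ (by rw [hwv i j h₁])
      by_cases hy : ∃ j, y = v j
      · obtain ⟨j, rfl⟩ := hy
        rcases nb j x h₃.symm with rfl | rfl | rfl
        · exact absurd rfl (hx _)
        · exact absurd rfl (hx _)
        · rw [kp']
          rcases icases i j with rfl | rfl | rfl | rfl
          · exact absurd h₁ (G.loopless.irrefl _)
          · exact pp i
          · exact pp' i h₁
          · have := pp (i + 3)
            rw [i31] at this
            exact this.symm
      · push Not at hy
        rw [out x y hx hy]
        refine hL i _ (pL i) x y h₁ h₂ h₃ h₄ fun hE => ?_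
        obtain ⟨j, -, hj⟩ := Finset.mem_image.1 hE
        rcases Sym2.eq_iff.1 hj with ⟨h, -⟩ | ⟨h, -⟩
        · exact hx j h.symm
        · exact hy j h.symm
  refine colorable_of_extension hk k' (fun e he => hout e fun i => he _ (by simp))
    fun z hz x hx f hf => ?_
  obtain ⟨i, -, rfl⟩ := Finset.mem_image.1 hz
  rcases nb i x hx with rfl | rfl | rfl
  · rw [kq]; exact C i f hf
  · rw [kq']
    refine C (i + 3) f ?_
    rwa [i31, Sym2.eq_swap]
  · rw [kp]; exact P i f hf

theorem injective_vec_four {α : Type*} {a b c d : α} (hab : a ≠ b) (hac : a ≠ c) (had : a ≠ d)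
    (hbc : b ≠ c) (hbd : b ≠ d) (hcd : c ≠ d) : Function.Injective ![a, b, c, d] := by
  have h : List.Nodup (List.ofFn ![a, b, c, d]) := by simp; tauto
  exact List.nodup_ofFn.1 h

/-- A 4-cycle is reducible in a graph without triangles. -/
theorem DeletionColorable.of_square (hdel : DeletionColorable G)
    (hdeg : ∀ v, G.degree v ≤ 3) (hcub : ∀ v x, G.Adj v x → G.degree v = 3)
    (htri : ∀ x y z, G.Adj x y → G.Adj y z → ¬ G.Adj x z) {a b c d : V}
    (hab : G.Adj a b) (hbc : G.Adj b c) (hcd : G.Adj c d) (hda : G.Adj d a) (hac : a ≠ c)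
    (hbd : b ≠ d) : (conflictGraph G).Colorable 7 := by
  by_cases hbip : ∃ u v x y z, u ≠ v ∧ G.Adj u x ∧ G.Adj u y ∧ G.Adj u z ∧ G.Adj v x ∧
      G.Adj v y ∧ G.Adj v z ∧ x ≠ y ∧ x ≠ z ∧ y ≠ z
  · obtain ⟨u, v, x, y, z, h₁, h₂, h₃, h₄, h₅, h₆, h₇, h₈, h₉, h₁₀⟩ := hbip
    exact hdel.of_bipartite hdeg h₁ h₂ h₃ h₄ h₅ h₆ h₇ h₈ h₉ h₁₀
  push Not at hbip
  obtain ⟨a', ha, hab', had'⟩ := exists_third_neighbor_of_cubic hcub hab hbd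
  obtain ⟨b', hb, hba', hbc'⟩ := exists_third_neighbor_of_cubic hcub hab.symm hac
  obtain ⟨c', hc, hcb', hcd'⟩ := exists_third_neighbor_of_cubic hcub hbc.symm hbd
  obtain ⟨d', hd, hda', hdc'⟩ := exists_third_neighbor_of_cubic hcub hda hac
  have e₁ : a' ≠ b' := by rintro rfl; exact htri _ _ _ ha hb.symm hab
  have e₂ : b' ≠ c' := by rintro rfl; exact htri _ _ _ hb hc.symm hbc
  have e₃ : c' ≠ d' := by rintro rfl; exact htri _ _ _ hc hd.symm hcd
  have e₄ : d' ≠ a' := by rintro rfl; exact htri _ _ _ hd ha.symm hda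
  have e₅ : a' ≠ c' := by
    rintro rfl
    exact had' (hbip a c b d a' hac hab hda.symm ha hbc.symm hcd hc hbd hab'.symm).symm
  have e₆ : b' ≠ d' := by
    rintro rfl
    exact hbc' (hbip b d a c b' hbd hab.symm hbc hb hda hcd.symm hd hac hba'.symm).symm
  have e₇ : a' ≠ c := by rintro rfl; exact htri _ _ _ hab hbc ha
  have e₈ : b' ≠ d := by rintro rfl; exact htri _ _ _ hbc hcd hb
  have e₉ : c' ≠ a := by rintro rfl; exact htri _ _ _ hab hbc hc.symm
  have e₁₀ : d' ≠ b := by rintro rfl; exact htri _ _ _ hbc hcd hd.symm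
  refine hdel.of_square_of_injective (v := ![a, b, c, d]) (w := ![a', b', c', d']) hdeg
    ?_ ?_ ?_ ?_ ?_
  · exact injective_vec_four hab.ne hac hda.ne' hbc.ne hbd hcd.ne
  · refine forall_fin_four.2 ⟨?_, ?_, ?_, ?_⟩ <;> rw [forall_fin_four]
    · exact ⟨ha.ne', hab', e₇, had'⟩
    · exact ⟨hba', hb.ne', hbc', e₈⟩
    · exact ⟨e₉, hcb', hc.ne', hcd'⟩
    · exact ⟨hda', e₁₀, hdc', hd.ne'⟩
  · exact injective_vec_four e₁ e₅ e₄.symm e₂ e₆ e₃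
  · exact forall_fin_four.2 ⟨hab, hbc, hcd, hda⟩
  · exact forall_fin_four.2 ⟨ha, hb, hc, hd⟩

end Reducible

/-! ### Reducibility of chorded octagons -/

section Reducible

/-- The cycle `a 0, b 0, a 1, b 1, …, b 3` of length eight with its chords `a i, a (i + 2)`. -/
structure IsChordedOctagon {V : Type*} (G : SimpleGraph V) (a b : Fin 4 → V) : Prop where
  injective_left : Function.Injective a
  left_ne_right : ∀ i j, a i ≠ b j
  injective_right : Function.Injective b
  adj_left_right : ∀ i, G.Adj (a i) (b i)
  adj_right_left : ∀ i, G.Adj (b i) (a (i + 1))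
  adj_chord : ∀ i, G.Adj (a i) (a (i + 2))

/-- The edges of a cycle `a 0, b 0, a 1, b 1, …, b 3` are distinct. -/
theorem injective_octagon_edges {V : Type*} {a b : Fin 4 → V} (ha : Function.Injective a)
    (hab : ∀ i j, a i ≠ b j) (hb : Function.Injective b) : Function.Injective
      (Sum.elim (fun i => s(a i, b i)) fun i => s(b i, a (i + 1)) : Fin 4 ⊕ Fin 4 → Sym2 V) := by
  have h1 : ∀ i : Fin 4, i ≠ i + 1 := by decide
  rintro (i | i) (j | j) h
  · rcases Sym2.eq_iff.1 h with ⟨h, -⟩ | ⟨h, -⟩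
    · rw [ha h]
    · exact absurd h (hab _ _)
  · rcases Sym2.eq_iff.1 h with ⟨h, -⟩ | ⟨h, h'⟩
    · exact absurd h (hab _ _)
    · exact absurd ((hb h').symm.trans (ha h)) (h1 j)
  · rcases Sym2.eq_iff.1 h with ⟨h, -⟩ | ⟨h, h'⟩
    · exact absurd h.symm (hab _ _)
    · exact absurd ((hb h).trans (ha h').symm) (h1 i)
  · rcases Sym2.eq_iff.1 h with ⟨h, -⟩ | ⟨h, -⟩
    · rw [hb h]
    · exact absurd h.symm (hab _ _)

/-- Prescribing the colours of the edges of the cycle `a 0, b 0, …, a 3, b 3`, of its chords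
`a i, a (i + 2)`, and of an edge leaving it at `b 3`. -/
theorem exists_override_octagon {V β : Type*} {a b : Fin 4 → V} {w : V}
    (ha : Function.Injective a) (hab : ∀ i j, a i ≠ b j) (hb : Function.Injective b)
    (hwa : ∀ i, w ≠ a i) (k : Sym2 V → β) (x y : Fin 4 → β) (t l : β) :
    ∃ c : Sym2 V → β, (∀ i, c s(a i, b i) = x i) ∧ (∀ i, c s(b i, a (i + 1)) = y i) ∧
      (∀ i, c s(a i, a (i + 2)) = t) ∧ c s(b 3, w) = l ∧
      ∀ e, (∀ i, a i ∉ e) → (∀ i, b i ∉ e) → c e = k e := by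
  classical
  have hinj := injective_octagon_edges ha hab hb
  have hch : ∀ i (u : V), ¬ ∃ j, s(b i, u) = s(a j, a (j + 2)) := by
    rintro i u ⟨j, h⟩
    rcases Sym2.eq_iff.1 h with ⟨h, -⟩ | ⟨h, -⟩ <;> exact hab _ _ h.symm
  have hp : ∀ i (u : V), s(a i, u) ≠ s(b 3, w) := by
    intro i u h
    rcases Sym2.eq_iff.1 h with ⟨h, -⟩ | ⟨h, -⟩
    · exact hab _ _ h
    · exact hwa _ h.symm
  refine ⟨fun e => if e = s(b 3, w) then l else if ∃ j, e = s(a j, a (j + 2)) then t else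
    Function.extend (Sum.elim (fun i => s(a i, b i)) fun i => s(b i, a (i + 1)))
      (Sum.elim x y) k e, fun i => ?_, fun i => ?_, fun i => ?_, if_pos rfl, fun e he he' => ?_⟩
  · have h1 := hch i (a i)
    rw [Sym2.eq_swap] at h1
    simp only [if_neg (hp i (b i)), if_neg h1]
    exact hinj.extend_apply _ _ (.inl i)
  · have h1 := hp (i + 1) (b i)
    rw [Sym2.eq_swap] at h1
    simp only [if_neg h1, if_neg (hch i (a (i + 1)))]
    exact hinj.extend_apply _ _ (.inr i)
  · simp only [if_neg (hp i (a (i + 2)))]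
    exact if_pos ⟨i, rfl⟩
  · have h1 : e ≠ s(b 3, w) := by rintro rfl; exact he' 3 (by simp)
    have h2 : ¬ ∃ j, e = s(a j, a (j + 2)) := by rintro ⟨j, rfl⟩; exact he j (by simp)
    simp only [if_neg h1, if_neg h2]
    refine Function.extend_apply' _ _ _ ?_
    rintro ⟨i | i, rfl⟩ <;> exact he' i (by simp)

variable {V : Type*} [Fintype V] [DecidableEq V] {G : SimpleGraph V} [DecidableRel G.Adj]

/-- Colours for the octagon: `x i` for the edge from `a i` to `b i`, `y i` for the edge from `b i`
to `a (i + 1)`, `l` for the edge leaving at `b 3` and `t` for the chords. For `i ≠ 3` the edge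
leaving at `b i` sees the same colour on its two conflicting edges `x (i + 1)`, `y (i + 3)`. The
proposition `P` says that the edges leaving at `b 1` and at `b 3` have a common end. -/
theorem exists_colors_octagon {A : Fin 4 → Finset (Fin 7)} {L : Finset (Fin 7)} {P : Prop}
    (hA : ∀ i, 5 ≤ (A i).card) (hL : 3 ≤ L.card) (hP : P → 5 ≤ L.card) :
    ∃ (x y : Fin 4 → Fin 7) (t l : Fin 7), (∀ i, x i ∈ A i) ∧ (∀ i, y i ∈ A i) ∧
      (∀ i, x i ≠ x (i + 1) ∧ x i ≠ x (i + 2) ∧ x i ≠ x (i + 3)) ∧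
      (∀ i, y i ≠ y (i + 1) ∧ y i ≠ y (i + 2) ∧ y i ≠ y (i + 3)) ∧
      (∀ i, x i ≠ y (i + 1)) ∧ (∀ i, t ≠ x i) ∧ (∀ i, t ≠ y i) ∧
      (∀ i, i ≠ 3 → x (i + 1) = y (i + 3)) ∧
      l ∈ L ∧ l ≠ x 0 ∧ l ≠ y 2 ∧ l ≠ t ∧ (P → l ≠ x 1 ∧ l ≠ y 1) := by
  obtain ⟨X, hX⟩ := Finset.card_pos.1
    (show 0 < (A 1 ∩ A 3).card by have := three_le_card_inter (hA 1) (hA 3); omega)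
  obtain ⟨Y, hY, hYX⟩ := exists_mem_ne
    (show 2 ≤ (A 1 ∩ A 3).card by have := three_le_card_inter (hA 1) (hA 3); omega) X
  obtain ⟨Z, hZ, hZX, hZY⟩ := exists_mem_ne_ne (three_le_card_inter (hA 0) (hA 2)) X Y
  obtain ⟨U, hU, hUX, hUY, hUZ⟩ := exists_mem_ne_ne_ne
    (show 4 ≤ (A 0).card by have := hA 0; omega) X Y Z
  obtain ⟨U', hU', hUX', hUY', hUZ'⟩ := exists_mem_ne_ne_ne
    (show 4 ≤ (A 2).card by have := hA 2; omega) X Y Z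
  rw [Finset.mem_inter] at hX hY hZ
  obtain ⟨l, hl, hlU, hlU', hlP⟩ : ∃ l ∈ L, l ≠ U ∧ l ≠ U' ∧ (P → l ≠ X ∧ l ≠ Y) := by
    by_cases h : P
    · obtain ⟨l, hl, hl'⟩ := Finset.exists_mem_notMem_of_card_lt_card
        (s := {U, U', X, Y}) (t := L) (Finset.card_le_four.trans_lt (hP h))
      simp only [Finset.mem_insert, Finset.mem_singleton, not_or] at hl'
      exact ⟨l, hl, hl'.1, hl'.2.1, fun _ => hl'.2.2⟩
    · obtain ⟨l, hl, h₁, h₂⟩ := exists_mem_ne_ne hL U U'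
      exact ⟨l, hl, h₁, h₂, fun h' => absurd h' h⟩
  obtain ⟨t, -, ht⟩ := Finset.exists_mem_notMem_of_card_lt_card
    (s := {X, Y, Z, U, U', l}) (t := Finset.univ)
    (Finset.card_le_six.trans_lt (by rw [Finset.card_univ, Fintype.card_fin]; omega))
  simp only [Finset.mem_insert, Finset.mem_singleton, not_or] at ht
  obtain ⟨htX, htY, htZ, htU, htU', htl⟩ := ht
  refine ⟨![U, X, Z, Y], ![Z, Y, U', X], t, l, forall_fin_four.2 ⟨hU, hX.1, hZ.2, hY.2⟩,
    forall_fin_four.2 ⟨hZ.1, hY.1, hU', hX.2⟩,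
    forall_fin_four.2 ⟨⟨hUX, hUZ, hUY⟩, ⟨hZX.symm, hYX.symm, hUX.symm⟩, ⟨hZY, hUZ.symm, hZX⟩,
      hUY.symm, hYX, hZY.symm⟩,
    forall_fin_four.2 ⟨⟨hZY, hUZ'.symm, hZX⟩, ⟨hUY'.symm, hYX, hZY.symm⟩, ⟨hUX', hUZ', hUY'⟩,
      hZX.symm, hYX.symm, hUX'.symm⟩,
    forall_fin_four.2 ⟨hUY, hUX'.symm, hZX, hZY.symm⟩,
    forall_fin_four.2 ⟨htU, htX, htZ, htY⟩, forall_fin_four.2 ⟨htZ, htY, htU', htX⟩,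
    forall_fin_four.2 ⟨fun _ => rfl, fun _ => rfl, fun _ => rfl, fun h => absurd rfl h⟩,
    hl, hlU, hlU', Ne.symm htl, hlP⟩

/-- A cycle of length eight with two crossing long chords is reducible in a graph without
triangles and 4-cycles. The edges of the octagon, the chords and one of the edges leaving it are
coloured at once; then each of the other edges leaving the octagon sees at most six colours. -/
theorem DeletionColorable.of_octagon (hdel : DeletionColorable G)
    (hdeg : ∀ v, G.degree v ≤ 3) (hcub : ∀ v x, G.Adj v x → G.degree v = 3)
    (htri : ∀ x y z, G.Adj x y → G.Adj y z → ¬ G.Adj x z)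
    (hsq : ∀ x y z w, G.Adj x y → G.Adj y z → G.Adj z w → G.Adj w x → x ≠ z → y = w)
    {a b : Fin 4 → V} (hoct : IsChordedOctagon G a b) : (conflictGraph G).Colorable 7 := by
  obtain ⟨ha, hab, hb, h₁, h₂, h₃⟩ := hoct
  have i11 : ∀ i : Fin 4, i + 1 + 1 = i + 2 := by decide
  have i12 : ∀ i : Fin 4, i + 1 + 2 = i + 3 := by decide
  have i13 : ∀ i : Fin 4, i + 1 + 3 = i := by decide
  have i21 : ∀ i : Fin 4, i + 2 + 1 = i + 3 := by decide
  have i22 : ∀ i : Fin 4, i + 2 + 2 = i := by decide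
  have i23 : ∀ i : Fin 4, i + 2 + 3 = i + 1 := by decide
  have i31 : ∀ i : Fin 4, i + 3 + 1 = i := by decide
  have i32 : ∀ i : Fin 4, i + 3 + 2 = i + 1 := by decide
  have i33 : ∀ i : Fin 4, i + 3 + 3 = i + 2 := by decide
  have j1 : ∀ i : Fin 4, i + 1 = 3 → i = 2 := by decide
  have j3 : ∀ i : Fin 4, i + 3 = 3 → i = 0 := by decide
  have icases : ∀ i j : Fin 4, j = i ∨ j = i + 1 ∨ j = i + 2 ∨ j = i + 3 := by decide
  have ine : ∀ i : Fin 4, i ≠ i + 1 := by decide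
  have ine2 : ∀ i : Fin 4, i ≠ i + 2 := by decide
  have ine3 : ∀ i : Fin 4, i ≠ i + 3 := by decide
  have h₂' : ∀ i, G.Adj (a i) (b (i + 3)) := fun i => by
    have := h₂ (i + 3)
    rw [i31] at this
    exact this.symm
  choose w hw hwa hwa' using fun i =>
    exists_third_neighbor_of_cubic hcub (h₁ i).symm (ha.ne (ine i))
  have na : ∀ i z, G.Adj (a i) z → z = b i ∨ z = b (i + 3) ∨ z = a (i + 2) := fun i =>
    eq_of_three_neighbors hdeg (h₁ i) (h₂' i) (h₃ i) (hb.ne (ine3 i)) (hab _ _).symm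
      (hab _ _).symm
  have nb : ∀ i z, G.Adj (b i) z → z = a i ∨ z = a (i + 1) ∨ z = w i := fun i =>
    eq_of_three_neighbors hdeg (h₁ i).symm (h₂ i) (hw i) (ha.ne (ine i)) (hwa i).symm
      (hwa' i).symm
  -- The outer ends lie outside the octagon, and consecutive ones are distinct.
  have wa : ∀ i j, w i ≠ a j := by
    intro i j e
    rcases na j (b i) (e ▸ (hw i).symm) with h | h | h
    · rw [hb h] at e
      exact hwa _ e
    · refine hwa' i ?_
      rw [e, hb h, i31]
    · exact hab _ _ h.symm
  have bb1 : ∀ i, ¬ G.Adj (b i) (b (i + 1)) := fun i =>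
    htri _ _ _ (h₂ i) (h₁ (i + 1))
  have wb : ∀ i j, w i ≠ b j := by
    intro i j e
    have h := hw i
    rw [e] at h
    rcases icases i j with rfl | rfl | rfl | rfl
    · exact G.loopless.irrefl _ h
    · exact bb1 _ h
    · exact hab _ _ (hsq _ _ _ _ (h₃ i) (h₁ (i + 2)) h.symm (h₁ i).symm (hab _ _))
    · refine bb1 (i + 3) ?_
      rw [i31]
      exact h.symm
  have ww1 : ∀ i, w i ≠ w (i + 1) := by
    intro i e
    have h := (hw (i + 1)).symm
    rw [← e] at h
    exact wa _ _ (hsq _ _ _ _ (hw i) h (h₁ (i + 1)).symm (h₂ i).symm (hb.ne (ine i)))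
  obtain ⟨k, hk⟩ := hdel (Finset.univ.image a ∪ Finset.univ.image b) ⟨a 0, by simp, b 0, h₁ 0⟩
  choose A cA hA using fun i => exists_palette_at hdeg k (hw i).symm
  -- The octagon edges at `b 1` are in conflict with the edge leaving at `b 3` if `w 1 = w 3`.
  obtain ⟨L, cL, hL⟩ := exists_palette_via hdeg k (hw 3).symm {s(b 1, a 1), s(b 1, a 2)}
  have hfive : w 1 = w 3 → 5 ≤ L.card := by
    intro e
    have hadj : G.Adj (w 3) (b 1) := e ▸ (hw 1).symm
    have hb13 : b 1 ≠ b 3 := hb.ne (by decide)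
    have hsub : ({s(b 1, a 1), s(b 1, a 2)} : Finset (Sym2 V)) ⊆
        conflictsVia G (w 3) (b 3) ∩ {s(b 1, a 1), s(b 1, a 2)} := by
      intro e he
      refine Finset.mem_inter.2 ⟨?_, he⟩
      rcases Finset.mem_insert.1 he with rfl | he
      · exact mem_conflictsVia hadj hb13 (h₁ 1).symm (wa _ _).symm
      · rw [Finset.mem_singleton.1 he]
        exact mem_conflictsVia hadj hb13 (h₂ 1) (wa _ _).symm
    have := Finset.card_le_card hsub
    rw [Finset.card_pair] at this
    · omega
    · intro h
      rcases Sym2.eq_iff.1 h with ⟨-, h⟩ | ⟨h, -⟩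
      · exact absurd (ha h) (by decide)
      · exact hab _ _ h.symm
  obtain ⟨x, y, t, l, hxA, hyA, hxx, hyy, hxy, htx, hty, hxy', hlL, hlx, hly, hlt, hlw⟩ :=
    exists_colors_octagon cA ((Nat.le_add_right _ _).trans cL) hfive
  obtain ⟨c, cx, cy, ct, cl, hout⟩ := exists_override_octagon ha hab hb (wa 3) k x y t l
  clear cA cL hfive
  have cx' : ∀ i, c s(b i, a i) = x i := fun i => by rw [Sym2.eq_swap, cx]
  have cy' : ∀ i, c s(a i, b (i + 3)) = y (i + 3) := fun i => by
    rw [Sym2.eq_swap, ← cy (i + 3), i31]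
  -- All edges except the three edges leaving the octagon that are coloured last.
  let S : Set (Sym2 V) := {e | ∀ i, i ≠ 3 → e ≠ s(b i, w i)}
  have hS : ∀ i, s(b i, w i) ∈ S → i = 3 := fun i h => by
    by_contra h3
    exact h i h3 rfl
  have hpa : ∀ j z i, s(a j, z) ≠ s(b i, w i) := fun j z i h => by
    rcases Sym2.eq_iff.1 h with ⟨h, -⟩ | ⟨h, -⟩
    · exact hab _ _ h
    · exact wa _ _ h.symm
  have hwin : ∀ i z, G.Adj z (b i) → (∀ j, z ≠ a j) → z = w i := fun i z h hz => by
    rcases nb i z h.symm with h | h | h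
    · exact absurd h (hz _)
    · exact absurd h (hz _)
    · exact h
  have ww3 : ∀ i, i ≠ 3 → w i = w 3 → i = 1 := by
    refine forall_fin_four.2 ⟨fun _ h => ?_, fun _ _ => rfl, fun _ h => ?_, fun h => ?_⟩
    · exact absurd h.symm (ww1 3)
    · exact absurd h (ww1 2)
    · exact absurd rfl h
  -- The colours of the edges at a vertex of the octagon, one edge being left out.
  have ob₁ : ∀ i z, G.Adj (b i) z → z ≠ a i → s(b i, z) ∈ S →
      c s(b i, z) = y i ∨ i = 3 ∧ c s(b i, z) = l := fun i z hz hne hs => by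
    rcases nb i z hz with rfl | rfl | rfl
    · exact absurd rfl hne
    · exact .inl (cy i)
    · obtain rfl := hS i hs
      exact .inr ⟨rfl, cl⟩
  have ob₂ : ∀ i z, G.Adj (b i) z → z ≠ a (i + 1) → s(b i, z) ∈ S →
      c s(b i, z) = x i ∨ i = 3 ∧ c s(b i, z) = l := fun i z hz hne hs => by
    rcases nb i z hz with rfl | rfl | rfl
    · exact .inl (cx' i)
    · exact absurd rfl hne
    · obtain rfl := hS i hs
      exact .inr ⟨rfl, cl⟩
  have oa₁ : ∀ i z, G.Adj (a i) z → z ≠ b i → c s(a i, z) = y (i + 3) ∨ c s(a i, z) = t :=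
    fun i z hz hne => by
    rcases na i z hz with rfl | rfl | rfl
    · exact absurd rfl hne
    · exact .inl (cy' i)
    · exact .inr (ct i)
  have oa₂ : ∀ i z, G.Adj (a i) z → z ≠ b (i + 3) → c s(a i, z) = x i ∨ c s(a i, z) = t :=
    fun i z hz hne => by
    rcases na i z hz with rfl | rfl | rfl
    · exact .inl (cx i)
    · exact absurd rfl hne
    · exact .inr (ct i)
  have oa₃ : ∀ i z, G.Adj (a i) z → z ≠ a (i + 2) →
      c s(a i, z) = x i ∨ c s(a i, z) = y (i + 3) := fun i z hz hne => by
    rcases na i z hz with rfl | rfl | rfl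
    · exact .inl (cx i)
    · exact .inr (cy' i)
    · exact absurd rfl hne
  have hout' : ∀ u v, (∀ i, u ≠ a i) → (∀ i, u ≠ b i) → (∀ i, v ≠ a i) → (∀ i, v ≠ b i) →
      c s(u, v) = k s(u, v) := fun u v h₁ h₂ h₃ h₄ => by
    refine hout _ (fun i h => ?_) fun i h => ?_
    · rcases Sym2.mem_iff.1 h with h | h
      exacts [h₁ i h.symm, h₃ i h.symm]
    · rcases Sym2.mem_iff.1 h with h | h
      exacts [h₂ i h.symm, h₄ i h.symm]
  have ow : ∀ i z, G.Adj (w i) z → z ≠ b i → s(w i, z) ∈ S →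
      x i ≠ c s(w i, z) ∧ y i ≠ c s(w i, z) := fun i z hz hne hs => by
    by_cases hzb : ∃ j, z = b j
    · obtain ⟨j, rfl⟩ := hzb
      have hij := hwin j _ hz (wa i)
      rw [hij, Sym2.eq_swap] at hs ⊢
      obtain rfl := hS j hs
      obtain rfl := ww3 i (fun h => hne (by rw [h])) hij
      rw [cl]
      exact ⟨(hlw hij).1.symm, (hlw hij).2.symm⟩
    · have hza : ∀ j, z ≠ a j := by
        rintro j rfl
        rcases na j _ hz.symm with h | h | h
        exacts [wb _ _ h, wb _ _ h, wa _ _ h]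
      rw [hout' _ _ (wa i) (wb i) hza (not_exists.1 hzb)]
      exact ⟨hA i _ (hxA i) z hz hne, hA i _ (hyA i) z hz hne⟩
  have ow₃ : ∀ z v, G.Adj (w 3) z → z ≠ b 3 → G.Adj z v → v ≠ w 3 → s(z, v) ∈ S →
      l ≠ c s(z, v) := fun z v hz hzb hv hvw hs => by
    have hza : ∀ j, z ≠ a j := by
      rintro j rfl
      rcases na j _ hz.symm with h | h | h
      exacts [wb _ _ h, wb _ _ h, wa _ _ h]
    by_cases hzb' : ∃ j, z = b j
    · obtain ⟨j, rfl⟩ := hzb'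
      have hj := hwin j _ hz (wa 3)
      obtain rfl := ww3 j (fun h => hzb (by rw [h])) hj.symm
      rcases nb 1 v hv with rfl | rfl | rfl
      · rw [cx']
        exact (hlw hj.symm).1
      · rw [cy]
        exact (hlw hj.symm).2
      · exact absurd hj.symm hvw
    · have hva : ∀ j, v ≠ a j := by
        rintro j rfl
        rcases na j _ hv.symm with h | h | h
        exacts [hzb' ⟨_, h⟩, hzb' ⟨_, h⟩, hza _ h]
      have hvb : ∀ j, v ≠ b j := by
        rintro j rfl
        have hj := hwin j _ hv hza
        rw [hj, Sym2.eq_swap] at hs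
        obtain rfl := hS j hs
        exact G.loopless.irrefl _ (hj ▸ hz)
      rw [hout' _ _ hza (not_exists.1 hzb') hva hvb]
      refine hL l hlL z v hz hzb hv hvw fun h => ?_
      rcases Finset.mem_insert.1 h with h | h
      · rcases Sym2.eq_iff.1 h with ⟨h, -⟩ | ⟨h, -⟩
        exacts [hzb' ⟨_, h⟩, hza _ h]
      · rcases Sym2.eq_iff.1 (Finset.mem_singleton.1 h) with ⟨h, -⟩ | ⟨h, -⟩
        exacts [hzb' ⟨_, h⟩, hza _ h]
  have kx : ∀ i, ∀ f ∈ S, (conflictGraph G).Adj s(a i, b i) f → x i ≠ c f := by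
    intro i f hf h
    rcases exists_of_conflictGraph_adj h with ⟨r, z, hr, hrb, hz, hza, rfl⟩ |
      ⟨r, z, hr, hra, hz, hzb, rfl⟩
    · rcases na i r hr with rfl | rfl | rfl
      · exact absurd rfl hrb
      · rcases ob₂ (i + 3) z hz (by rwa [i31]) hf with e | ⟨h3, e⟩
        · rw [e]
          exact (hxx i).2.2
        · obtain rfl : i = 0 := j3 i h3
          rw [e]
          exact hlx.symm
      · rcases oa₃ (i + 2) z hz (by rwa [i22]) with e | e
        · rw [e]
          exact (hxx i).2.1
        · rw [e, i23]
          exact hxy i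
    · rcases nb i r hr with rfl | rfl | rfl
      · exact absurd rfl hra
      · rcases oa₂ (i + 1) z hz (by rwa [i13]) with e | e
        · rw [e]
          exact (hxx i).1
        · rw [e]
          exact (htx i).symm
      · exact (ow i z hz hzb hf).1
  have ky : ∀ i, ∀ f ∈ S, (conflictGraph G).Adj s(b i, a (i + 1)) f → y i ≠ c f := by
    intro i f hf h
    rcases exists_of_conflictGraph_adj h with ⟨r, z, hr, hra, hz, hzb, rfl⟩ |
      ⟨r, z, hr, hrb, hz, hza, rfl⟩
    · rcases nb i r hr with rfl | rfl | rfl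
      · rcases oa₁ i z hz hzb with e | e
        · rw [e]
          exact (hyy i).2.2
        · rw [e]
          exact (hty i).symm
      · exact absurd rfl hra
      · exact (ow i z hz hzb hf).2
    · rcases na (i + 1) r hr with rfl | rfl | rfl
      · rcases ob₁ (i + 1) z hz hza hf with e | ⟨h3, e⟩
        · rw [e]
          exact (hyy i).1
        · obtain rfl : i = 2 := j1 i h3
          rw [e]
          exact hly.symm
      · exact absurd (by rw [i13]) hrb
      · rw [i12] at hz hf ⊢
        rcases oa₃ (i + 3) z hz (by rwa [i32]) with e | e
        · rw [e]
          have := hxy (i + 3)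
          rw [i31] at this
          exact this.symm
        · rw [e, i33]
          exact (hyy i).2.1
  have kt : ∀ i r z, G.Adj (a i) r → r ≠ a (i + 2) → G.Adj r z → z ≠ a i → s(r, z) ∈ S →
      t ≠ c s(r, z) := by
    intro i r z hr hra hz hza hs
    rcases na i r hr with rfl | rfl | rfl
    · rcases ob₁ i z hz hza hs with e | ⟨-, e⟩
      · rw [e]
        exact hty i
      · rw [e]
        exact hlt.symm
    · rcases ob₂ (i + 3) z hz (by rwa [i31]) hs with e | ⟨-, e⟩
      · rw [e]
        exact htx _
      · rw [e]
        exact hlt.symm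
    · exact absurd rfl hra
  have kt' : ∀ i, ∀ f ∈ S, (conflictGraph G).Adj s(a i, a (i + 2)) f → t ≠ c f := by
    intro i f hf h
    rcases exists_of_conflictGraph_adj h with ⟨r, z, hr, hra, hz, hza, rfl⟩ |
      ⟨r, z, hr, hra, hz, hza, rfl⟩
    · exact kt i r z hr hra hz hza hf
    · exact kt (i + 2) r z hr (by rwa [i22]) hz hza hf
  have kl : ∀ f ∈ S, (conflictGraph G).Adj s(b 3, w 3) f → l ≠ c f := by
    intro f hf h
    rcases exists_of_conflictGraph_adj h with ⟨r, z, hr, hrw, hz, hzb, rfl⟩ |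
      ⟨r, z, hr, hrb, hz, hzw, rfl⟩
    · rcases nb 3 r hr with rfl | rfl | rfl
      · rcases oa₁ 3 z hz hzb with e | e
        · rw [e]
          exact hly
        · rw [e]
          exact hlt
      · rcases oa₂ (3 + 1) z hz hzb with e | e
        · rw [e]
          exact hlx
        · rw [e]
          exact hlt
      · exact absurd rfl hrw
    · exact ow₃ r z hr hrb hz hzw hf
  have kab : ∀ e ∈ S, ∀ f ∈ S, (conflictGraph G).Adj e f →
      ((∃ i, a i ∈ e) ∨ ∃ i, b i ∈ e) → c e ≠ c f := by
    have key : ∀ i z, G.Adj (b i) z → s(b i, z) ∈ S → ∀ f ∈ S,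
        (conflictGraph G).Adj s(b i, z) f → c s(b i, z) ≠ c f := by
      intro i z hz he f hf h
      rcases nb i z hz with rfl | rfl | rfl
      · rw [Sym2.eq_swap] at h ⊢
        rw [cx]
        exact kx i f hf h
      · rw [cy]
        exact ky i f hf h
      · obtain rfl := hS i he
        rw [cl]
        exact kl f hf h
    intro e he f hf h hm
    obtain ⟨u, v, rfl, huv⟩ := exists_adj_of_conflictGraph_adj h
    by_cases hbe : ∃ i, b i ∈ s(u, v)
    · obtain ⟨i, hi⟩ := hbe
      rcases Sym2.mem_iff.1 hi with rfl | rfl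
      · exact key i v huv he f hf h
      · rw [Sym2.eq_swap] at he h ⊢
        exact key i u huv.symm he f hf h
    · obtain ⟨i, hi⟩ := hm.resolve_right hbe
      rcases Sym2.mem_iff.1 hi with rfl | rfl
      · rcases na i v huv with rfl | rfl | rfl
        · exact absurd ⟨_, Sym2.mem_mk_right _ _⟩ hbe
        · exact absurd ⟨_, Sym2.mem_mk_right _ _⟩ hbe
        · rw [ct]
          exact kt' i f hf h
      · rcases na i u huv.symm with rfl | rfl | rfl
        · exact absurd ⟨_, Sym2.mem_mk_left _ _⟩ hbe
        · exact absurd ⟨_, Sym2.mem_mk_left _ _⟩ hbe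
        · rw [Sym2.eq_swap] at h ⊢
          rw [ct]
          exact kt' i f hf h
  have hproper : ProperOn (conflictGraph G) c S := by
    intro e he f hf h
    by_cases hm : (∃ i, a i ∈ e) ∨ ∃ i, b i ∈ e
    · exact kab e he f hf h hm
    by_cases hm' : (∃ i, a i ∈ f) ∨ ∃ i, b i ∈ f
    · exact (kab f hf e he h.symm hm').symm
    have hmem : ∀ e, ¬ ((∃ i, a i ∈ e) ∨ ∃ i, b i ∈ e) →
        c e = k e ∧ ∀ v ∈ Finset.univ.image a ∪ Finset.univ.image b, v ∉ e := by
      intro e hm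
      rw [not_or, not_exists, not_exists] at hm
      refine ⟨hout e hm.1 hm.2, fun v hv => ?_⟩
      rcases Finset.mem_union.1 hv with hv | hv <;> obtain ⟨i, -, rfl⟩ := Finset.mem_image.1 hv
      exacts [hm.1 i, hm.2 i]
    rw [(hmem e hm).1, (hmem f hm').1]
    exact hk e (hmem e hm).2 f (hmem f hm').2 h
  -- An edge leaving the octagon at `b i` with `i ≠ 3` sees at most two colours past `b i`.
  have step : ∀ i, i ≠ 3 → ∀ (c' : Sym2 V → Fin 7) (T : Set (Sym2 V)),
      ProperOn (conflictGraph G) c' T → (∀ j z, c' s(a j, z) = c s(a j, z)) →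
      ∃ c'', ProperOn (conflictGraph G) c'' (insert s(b i, w i) T) ∧
        ∀ j z, c'' s(a j, z) = c s(a j, z) := by
    intro i hi c' T hc' hcc
    have hB : ({x (i + 1), t} ∪ (conflictsVia G (w i) (b i)).image c').card < 7 := by
      have h1 := Finset.card_union_le {x (i + 1), t} ((conflictsVia G (w i) (b i)).image c')
      have h2 := Finset.card_image_le (s := conflictsVia G (w i) (b i)) (f := c')
      have h3 := card_conflictsVia_le_four hdeg (hw i).symm
      have h4 := Finset.card_le_two (a := x (i + 1)) (b := t)
      omega
    obtain ⟨c'', h₁, h₂⟩ := hc'.exists_insert (v := s(b i, w i)) _ hB fun f hf hne h => by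
      rcases exists_of_conflictGraph_adj h with ⟨r, z, hr, hrw, hz, hzb, rfl⟩ |
        ⟨r, z, hr, hrb, hz, hzw, rfl⟩
      · refine Finset.mem_union_left _ ?_
        rw [Finset.mem_insert, Finset.mem_singleton]
        rcases nb i r hr with rfl | rfl | rfl
        · rw [hcc, hxy' i hi]
          exact oa₁ i z hz hzb
        · rw [hcc]
          exact oa₂ (i + 1) z hz (by rwa [i13])
        · exact absurd rfl hrw
      · exact Finset.mem_union_right _
          (Finset.mem_image_of_mem _ (mem_conflictsVia hr hrb hz hzw))
    exact ⟨c'', h₁, fun j z => by rw [h₂ _ (hpa j z i), hcc]⟩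
  obtain ⟨c₀, hc₀, h₀⟩ := step 0 (by decide) c S hproper fun _ _ => rfl
  obtain ⟨c₁, hc₁, h₁⟩ := step 1 (by decide) c₀ _ hc₀ h₀
  obtain ⟨c₂, hc₂, -⟩ := step 2 (by decide) c₁ _ hc₁ h₁
  refine hc₂.colorable fun e _ _ => ?_
  by_cases he : e ∈ S
  · exact .inr (.inr (.inr he))
  · obtain ⟨i, hi⟩ := not_forall.1 he
    obtain ⟨hi', rfl⟩ : i ≠ 3 ∧ e = s(b i, w i) := by
      rw [Classical.not_imp, not_not] at hi
      exact hi
    exact forall_fin_four (P := fun i => i ≠ 3 →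
      s(b i, w i) ∈ insert s(b 2, w 2) (insert s(b 1, w 1) (insert s(b 0, w 0) S))).2
      ⟨fun _ => .inr (.inr (.inl rfl)), fun _ => .inr (.inl rfl), fun _ => .inl rfl,
        fun h => absurd rfl h⟩ i hi'

end Reducible

/-! ### Four pairwise conflicting edges -/

section Clique

variable {V : Type*} {G : SimpleGraph V}

/-- In a graph without triangles, two conflicting edges are disjoint and joined by an edge. -/
theorem disjoint_and_joined_of_conflictGraph_adj
    (htri : ∀ x y z, G.Adj x y → G.Adj y z → ¬ G.Adj x z)
    {u v p q : V} (h : (conflictGraph G).Adj s(u, v) s(p, q)) :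
    (u ≠ p ∧ u ≠ q ∧ v ≠ p ∧ v ≠ q) ∧ (G.Adj u p ∨ G.Adj u q ∨ G.Adj v p ∨ G.Adj v q) := by
  obtain ⟨x, y, z, w, h₁, h₂, hxy, hyz, hzw, hxz, hyw⟩ := h
  have hxw : x ≠ w := by
    rintro rfl
    exact htri _ _ _ hxy hyz hzw.symm
  rcases Sym2.eq_iff.1 h₁ with ⟨rfl, rfl⟩ | ⟨rfl, rfl⟩ <;>
    rcases Sym2.eq_iff.1 h₂ with ⟨rfl, rfl⟩ | ⟨rfl, rfl⟩
  · exact ⟨⟨hxz, hxw, hyz.ne, hyw⟩, .inr (.inr (.inl hyz))⟩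
  · exact ⟨⟨hxw, hxz, hyw, hyz.ne⟩, .inr (.inr (.inr hyz))⟩
  · exact ⟨⟨hyz.ne, hyw, hxz, hxw⟩, .inl hyz⟩
  · exact ⟨⟨hyw, hyz.ne, hxw, hxz⟩, .inr (.inl hyz)⟩

theorem exists_end_of_conflictGraph_adj {u v : V} {f : Sym2 V}
    (h : (conflictGraph G).Adj s(u, v) f) :
    ∃ x y, f = s(x, y) ∧ G.Adj x y ∧ (G.Adj u x ∨ G.Adj v x) := by
  rcases exists_of_conflictGraph_adj h with ⟨x, y, hx, -, hy, -, rfl⟩ | ⟨x, y, hx, -, hy, -, rfl⟩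
  exacts [⟨x, y, rfl, hy, .inl hx⟩, ⟨x, y, rfl, hy, .inr hx⟩]

/-- Four edges that are pairwise in conflict and the edges joining them form a chorded octagon,
provided that they are joined in this particular way. -/
theorem isChordedOctagon_of_conflictGraph_adj
    (htri : ∀ x y z, G.Adj x y → G.Adj y z → ¬ G.Adj x z)
    {a b x₂ y₂ x₃ y₃ x₄ y₄ : V} (hab : G.Adj a b) (h₂ : G.Adj x₂ y₂) (h₃ : G.Adj x₃ y₃)
    (h₄ : G.Adj x₄ y₄) (hb₂ : G.Adj b x₂) (ha₃ : G.Adj a x₃) (ha₄ : G.Adj a x₄)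
    (h₃₄ : G.Adj y₃ y₄) (h₂₃ : G.Adj x₂ y₃) (h₂₄ : G.Adj y₂ x₄)
    (c₂ : (conflictGraph G).Adj s(a, b) s(x₂, y₂)) (c₃ : (conflictGraph G).Adj s(a, b) s(x₃, y₃))
    (c₄ : (conflictGraph G).Adj s(a, b) s(x₄, y₄))
    (c₂₃ : (conflictGraph G).Adj s(x₂, y₂) s(x₃, y₃))
    (c₂₄ : (conflictGraph G).Adj s(x₂, y₂) s(x₄, y₄))
    (c₃₄ : (conflictGraph G).Adj s(x₃, y₃) s(x₄, y₄)) :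
    IsChordedOctagon G ![a, x₂, x₄, y₃] ![b, y₂, y₄, x₃] := by
  obtain ⟨⟨n₁, n₂, n₃, n₄⟩, -⟩ := disjoint_and_joined_of_conflictGraph_adj htri c₂
  obtain ⟨⟨n₅, n₆, n₇, n₈⟩, -⟩ := disjoint_and_joined_of_conflictGraph_adj htri c₃
  obtain ⟨⟨n₉, n₁₀, n₁₁, n₁₂⟩, -⟩ := disjoint_and_joined_of_conflictGraph_adj htri c₄
  obtain ⟨⟨m₁, m₂, m₃, m₄⟩, -⟩ := disjoint_and_joined_of_conflictGraph_adj htri c₂₃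
  obtain ⟨⟨m₅, m₆, m₇, m₈⟩, -⟩ := disjoint_and_joined_of_conflictGraph_adj htri c₂₄
  obtain ⟨⟨m₉, m₁₀, m₁₁, m₁₂⟩, -⟩ := disjoint_and_joined_of_conflictGraph_adj htri c₃₄
  exact {
    injective_left := injective_vec_four n₁ n₉ n₆ m₅ m₂ m₁₁.symm
    injective_right := injective_vec_four n₄ n₁₂ n₇ m₈ m₃ m₁₀.symm
    left_ne_right := forall_fin_four.2 ⟨forall_fin_four.2 ⟨hab.ne, n₂, n₁₀, n₅⟩,
      forall_fin_four.2 ⟨n₃.symm, h₂.ne, m₆, m₁⟩,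
      forall_fin_four.2 ⟨n₁₁.symm, m₇.symm, h₄.ne, m₉.symm⟩,
      forall_fin_four.2 ⟨n₈.symm, m₄.symm, m₁₂, h₃.ne'⟩⟩
    adj_left_right := forall_fin_four.2 ⟨hab, h₂, h₄, h₃.symm⟩
    adj_right_left := forall_fin_four.2 ⟨hb₂, h₂₄, h₃₄.symm, ha₃.symm⟩
    adj_chord := forall_fin_four.2 ⟨ha₄, h₂₃, ha₄.symm, h₂₃.symm⟩ }

/-- If the edge `ab` is joined at `b` to `x₂y₂` and at `a` to both `x₃y₃` and `x₄y₄`, then the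
edges joining the last three to each other are forced, up to symmetry, by the absence of
triangles and 4-cycles. -/
theorem exists_isChordedOctagon (htri : ∀ x y z, G.Adj x y → G.Adj y z → ¬ G.Adj x z)
    (hsq : ∀ x y z w, G.Adj x y → G.Adj y z → G.Adj z w → G.Adj w x → x ≠ z → y = w)
    {a b x₂ y₂ x₃ y₃ x₄ y₄ : V} (hab : G.Adj a b) (h₂ : G.Adj x₂ y₂) (h₃ : G.Adj x₃ y₃)
    (h₄ : G.Adj x₄ y₄) (hb₂ : G.Adj b x₂) (ha₃ : G.Adj a x₃) (ha₄ : G.Adj a x₄)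
    (c₂ : (conflictGraph G).Adj s(a, b) s(x₂, y₂)) (c₃ : (conflictGraph G).Adj s(a, b) s(x₃, y₃))
    (c₄ : (conflictGraph G).Adj s(a, b) s(x₄, y₄))
    (c₂₃ : (conflictGraph G).Adj s(x₂, y₂) s(x₃, y₃))
    (c₂₄ : (conflictGraph G).Adj s(x₂, y₂) s(x₄, y₄))
    (c₃₄ : (conflictGraph G).Adj s(x₃, y₃) s(x₄, y₄)) : ∃ a b, IsChordedOctagon G a b := by
  obtain ⟨⟨n₁, n₂, n₃, n₄⟩, -⟩ := disjoint_and_joined_of_conflictGraph_adj htri c₂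
  obtain ⟨⟨n₅, n₆, n₇, n₈⟩, -⟩ := disjoint_and_joined_of_conflictGraph_adj htri c₃
  obtain ⟨⟨n₉, n₁₀, n₁₁, n₁₂⟩, -⟩ := disjoint_and_joined_of_conflictGraph_adj htri c₄
  obtain ⟨⟨m₁, m₂, m₃, m₄⟩, j₂₃⟩ := disjoint_and_joined_of_conflictGraph_adj htri c₂₃
  obtain ⟨⟨m₅, m₆, m₇, m₈⟩, j₂₄⟩ := disjoint_and_joined_of_conflictGraph_adj htri c₂₄
  obtain ⟨⟨m₉, m₁₀, m₁₁, m₁₂⟩, j₃₄⟩ := disjoint_and_joined_of_conflictGraph_adj htri c₃₄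
  have h34 : G.Adj y₃ y₄ := by
    rcases j₃₄ with h | h | h | h
    · exact absurd ha₄ (htri _ _ _ ha₃ h)
    · exact absurd (hsq _ _ _ _ ha₃ h h₄.symm ha₄.symm n₁₀) m₉
    · exact absurd (hsq _ _ _ _ ha₃ h₃ h ha₄.symm n₆) m₉
    · exact h
  have hx₃ : ¬ G.Adj x₂ x₃ := fun h => n₇ (hsq _ _ _ _ hab hb₂ h ha₃.symm n₁)
  have hx₄ : ¬ G.Adj x₂ x₄ := fun h => n₁₁ (hsq _ _ _ _ hab hb₂ h ha₄.symm n₁)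
  have hy₃ : ¬ G.Adj y₂ y₃ := fun h => by
    rcases j₂₄ with h' | h' | h' | h'
    · exact hx₄ h'
    · exact m₂ (hsq _ _ _ _ h h34 h'.symm h₂ m₈).symm
    · exact m₁₁ (hsq _ _ _ _ h h34 h₄.symm h'.symm m₈)
    · exact htri _ _ _ h h34 h'
  rcases j₂₃ with h | h | h | h
  · exact absurd h hx₃
  · rcases j₂₄ with h' | h' | h' | h'
    · exact absurd h' hx₄
    · exact absurd h' (htri _ _ _ h h34)
    · exact ⟨_, _, isChordedOctagon_of_conflictGraph_adj htri hab h₂ h₃ h₄ hb₂ ha₃ ha₄ h34 h h'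
        c₂ c₃ c₄ c₂₃ c₂₄ c₃₄⟩
    · exact absurd (hsq _ _ _ _ h h34 h'.symm h₂.symm m₆).symm m₄
  · rcases j₂₄ with h' | h' | h' | h'
    · exact absurd h' hx₄
    · exact ⟨_, _, isChordedOctagon_of_conflictGraph_adj htri hab h₂ h₄ h₃ hb₂ ha₄ ha₃ h34.symm
        h' h c₂ c₄ c₃ c₂₄ c₂₃ c₃₄.symm⟩
    · exact absurd (hsq _ _ _ _ h ha₃.symm ha₄ h'.symm n₂.symm) m₉
    · exact absurd (hsq _ _ _ _ h h₃ h34 h'.symm m₄) m₁₀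
  · exact absurd h hy₃

variable [Fintype V] [DecidableEq V] [DecidableRel G.Adj]

/-- In a subcubic graph without triangles and 4-cycles, four pairwise conflicting edges lie in a
chorded octagon. By the bound on the degree, the first of them is joined to the others at both of
its ends, to one of them at one end and to two of them at the other. -/
theorem exists_isChordedOctagon_of_clique (hdeg : ∀ v, G.degree v ≤ 3)
    (htri : ∀ x y z, G.Adj x y → G.Adj y z → ¬ G.Adj x z)
    (hsq : ∀ x y z w, G.Adj x y → G.Adj y z → G.Adj z w → G.Adj w x → x ≠ z → y = w)
    {e₁ e₂ e₃ e₄ : Sym2 V} (c₂ : (conflictGraph G).Adj e₁ e₂) (c₃ : (conflictGraph G).Adj e₁ e₃)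
    (c₄ : (conflictGraph G).Adj e₁ e₄) (c₂₃ : (conflictGraph G).Adj e₂ e₃)
    (c₂₄ : (conflictGraph G).Adj e₂ e₄) (c₃₄ : (conflictGraph G).Adj e₃ e₄) :
    ∃ a b, IsChordedOctagon G a b := by
  obtain ⟨a, b, rfl, hab⟩ := exists_adj_of_conflictGraph_adj c₂
  obtain ⟨x₂, y₂, rfl, h₂, j₂⟩ := exists_end_of_conflictGraph_adj c₂
  obtain ⟨x₃, y₃, rfl, h₃, j₃⟩ := exists_end_of_conflictGraph_adj c₃
  obtain ⟨x₄, y₄, rfl, h₄, j₄⟩ := exists_end_of_conflictGraph_adj c₄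
  have d₂ := c₂
  have d₃ := c₃
  have d₄ := c₄
  rw [Sym2.eq_swap (a := a)] at d₂ d₃ d₄
  have m := disjoint_and_joined_of_conflictGraph_adj htri c₂₃ |>.1.1
  have m' := disjoint_and_joined_of_conflictGraph_adj htri c₂₄ |>.1.1
  have m'' := disjoint_and_joined_of_conflictGraph_adj htri c₃₄ |>.1.1
  have not_all : ∀ u v, G.Adj u v → G.Adj u x₂ → G.Adj u x₃ → G.Adj u x₄ →
      v ≠ x₂ → v ≠ x₃ → v ≠ x₄ → False := fun u v huv h h' h'' n n' n'' => by
    rcases eq_of_three_neighbors hdeg h h' h'' m m' m'' v huv with rfl | rfl | rfl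
    exacts [n rfl, n' rfl, n'' rfl]
  rcases j₂ with j₂ | j₂ <;> rcases j₃ with j₃ | j₃ <;> rcases j₄ with j₄ | j₄
  · exact (not_all a b hab j₂ j₃ j₄
      (disjoint_and_joined_of_conflictGraph_adj htri c₂).1.2.2.1
      (disjoint_and_joined_of_conflictGraph_adj htri c₃).1.2.2.1
      (disjoint_and_joined_of_conflictGraph_adj htri c₄).1.2.2.1).elim
  · exact exists_isChordedOctagon htri hsq hab h₄ h₂ h₃ j₄ j₂ j₃ c₄ c₂ c₃ c₂₄.symm c₃₄.symm c₂₃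
  · exact exists_isChordedOctagon htri hsq hab h₃ h₂ h₄ j₃ j₂ j₄ c₃ c₂ c₄ c₂₃.symm c₃₄ c₂₄
  · exact exists_isChordedOctagon htri hsq hab.symm h₂ h₃ h₄ j₂ j₃ j₄ d₂ d₃ d₄ c₂₃ c₂₄ c₃₄
  · exact exists_isChordedOctagon htri hsq hab h₂ h₃ h₄ j₂ j₃ j₄ c₂ c₃ c₄ c₂₃ c₂₄ c₃₄
  · exact exists_isChordedOctagon htri hsq hab.symm h₃ h₂ h₄ j₃ j₂ j₄ d₃ d₂ d₄ c₂₃.symm c₃₄ c₂₄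
  · exact exists_isChordedOctagon htri hsq hab.symm h₄ h₂ h₃ j₄ j₂ j₃ d₄ d₂ d₃ c₂₄.symm c₃₄.symm
      c₂₃
  · exact (not_all b a hab.symm j₂ j₃ j₄
      (disjoint_and_joined_of_conflictGraph_adj htri c₂).1.1
      (disjoint_and_joined_of_conflictGraph_adj htri c₃).1.1
      (disjoint_and_joined_of_conflictGraph_adj htri c₄).1.1).elim

end Clique

/-! ### Induction on the number of edges -/

section Induction

variable {V : Type*}

/-- The induction hypothesis for the proper subgraphs of `G`, in the form in which it is used.
The conflicts of `G` among edges that avoid `W` are conflicts of the graph without `W`, because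
the walks witnessing them avoid `W` as well. -/
theorem deletionColorable_of_forall_lt {G : SimpleGraph V}
    (h : ∀ G' < G, (conflictGraph G').Colorable 7) : DeletionColorable G := by
  rintro W ⟨w, hw, x, hwx⟩
  have hadj : ∀ u v, (G.deleteEdges {e | ∃ w ∈ W, w ∈ e}).Adj u v ↔
      G.Adj u v ∧ ∀ w ∈ W, w ∉ s(u, v) := fun u v => by
    simp only [deleteEdges_adj, Set.mem_ofPred_eq, not_exists, not_and]
  have hlt : G.deleteEdges {e | ∃ w ∈ W, w ∈ e} < G := by
    refine lt_of_le_of_ne (deleteEdges_le _) fun e => ?_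
    have := hwx
    rw [← e, hadj] at this
    exact this.2 w hw (by simp)
  obtain ⟨C⟩ := h _ hlt
  refine ⟨C, fun e he f hf hef => C.valid ?_⟩
  obtain ⟨u, x, y, v, rfl, rfl, h₁, h₂, h₃, h₄, h₅⟩ := hef
  refine conflictGraph_adj_of_walk ((hadj _ _).2 ⟨h₁, he⟩) ((hadj _ _).2 ⟨h₂, ?_⟩)
    ((hadj _ _).2 ⟨h₃, hf⟩) h₄ h₅
  intro w hw hm
  rcases Sym2.mem_iff.1 hm with rfl | rfl
  exacts [he _ hw (by simp), hf _ hw (by simp)]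

variable [Fintype V] [DecidableEq V]

/-- The conflict graph of a subcubic graph is 7-colourable. -/
theorem conflictGraph_colorable_seven (G : SimpleGraph V) :
    ∀ [DecidableRel G.Adj], (∀ v, G.degree v ≤ 3) → (conflictGraph G).Colorable 7 := by
  classical
  induction G using WellFoundedLT.induction with
  | ind G ih =>
  intro _ hdeg
  have hdel : DeletionColorable G := deletionColorable_of_forall_lt fun G' hlt =>
    ih G' hlt fun v => (degree_le_of_le hlt.le).trans (hdeg v)
  by_contra hcol
  have hcub : ∀ v x, G.Adj v x → G.degree v = 3 := fun v x hvx => by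
    refine le_antisymm (hdeg v) ?_
    by_contra h
    exact hcol (hdel.of_degree_le_two hdeg hvx (by omega))
  have htri : ∀ x y z, G.Adj x y → G.Adj y z → ¬ G.Adj x z := fun x y z hxy hyz hxz =>
    hcol (hdel.of_triangle hdeg hcub hxy hxz hyz)
  have hsq : ∀ x y z w, G.Adj x y → G.Adj y z → G.Adj z w → G.Adj w x → x ≠ z → y = w := by
    intro x y z w hxy hyz hzw hwx hne
    by_contra hyw
    exact hcol (hdel.of_square hdeg hcub htri hxy hyz hzw hwx hne hyw)
  refine hcol (colorable_seven_of_degree_le_eight _ (degree_conflictGraph_le hdeg) ?_)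
  intro e₁ e₂ e₃ e₄ c₂ c₃ c₄ c₂₃ c₂₄ c₃₄
  obtain ⟨a, b, h⟩ := exists_isChordedOctagon_of_clique hdeg htri hsq c₂ c₃ c₄ c₂₃ c₂₄ c₃₄
  exact hcol (hdel.of_octagon hdeg hcub htri hsq h)

end Induction
end SimpleGraph

theorem mainTheorem2 {V : Type*} [Fintype V] (G : SimpleGraph V) [DecidableRel G.Adj]
    (hG : G.maxDegree ≤ 3) : G.injChromaticIndex ≤ 7 := by
  classical
  exact SimpleGraph.injChromaticIndex_le_of_colorable
    (SimpleGraph.conflictGraph_colorable_seven G fun v => (G.degree_le_maxDegree v).trans hG)
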